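/- All graphs are finite and simple. The arboricity $\mathrm{ar}(G)$ of a graph $G$ is the minimum number of forests into which the edges of $G$ can be partitioned. Let $k\ge 0$ be an integer. In the arboricity-$k$ game on $G$, Maker and Breaker alternately claim one unclaimed edge of $G$ each, Maker moving first, until all edges are claimed; Maker wins if the graph formed by her edges at the end of the game has arboricity at least $k$. We say that Maker wins in $G$ if she has a winning strategy. **Theorem 6.1.** 1. For every graph $G$ and every integer $k\ge 0$, Maker wins the arboricity-$k$ game in $G$ if and only if $k\le\lceil \mathrm{ar}(G)/2\rceil$. 2. For $k=2$ this is the cycle game, in which the winning sets are the edge sets of the cycles of $G$: a set $M\subseteq E(G)$ of edges forms a graph of arboricity at least $2$ if and only if $M$ contains all the edges of a cycle of $G$; hence Maker wins the arboricity-$2$ game in $G$ if and only if she wins the cycle game in $G$. 3. Given a graph $G$ (by its adjacency matrix) and an integer $k$ (in binary), it can be decided in polynomial time whether Maker wins the arboricity-$k$ game in $G$. -/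

import Mathlib

/-! ### Maker-Breaker games -/

namespace MakerBreaker

inductive Player where
  | maker
  | breaker

/-- Let `U` be the (finite) set of unclaimed elements and `M` the set of elements that Maker has
claimed, and let `W` be the condition on Maker's final set under which she wins.
`MakerWinsFrom W p M U` says that Maker has a winning strategy from this position
when `p` is the player to move: the players alternate, each claiming one unclaimed element, until
all elements are claimed. On her turn Maker has to have some good move; on Breaker's turn
every move of his must be good for her. -/
inductive MakerWinsFrom {X : Type*} (W : Set X → Prop) : Player → Set X → Set X → Prop
  | finished (p : Player) (M : Set X) (hW : W M) : MakerWinsFrom W p M ∅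
  | makerMove (M U : Set X) (e : X) (he : e ∈ U)
      (h : MakerWinsFrom W Player.breaker (insert e M) (U \ {e})) :
      MakerWinsFrom W Player.maker M U
  | breakerMove (M U : Set X) (hU : U.Nonempty)
      (h : ∀ e ∈ U, MakerWinsFrom W Player.maker M (U \ {e})) :
      MakerWinsFrom W Player.breaker M U

/-- Maker, moving first on the empty board, has a winning strategy. -/
def MakerWins {X : Type*} (board : Set X) (W : Set X → Prop) : Prop :=
  MakerWinsFrom W Player.maker ∅ board

/-- The winning condition given by a family `𝓕` of winning sets:
Maker has claimed all the elements of some member of `𝓕`. -/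
def ClaimsSome {X : Type*} (𝓕 : Set (Set X)) (M : Set X) : Prop :=
  ∃ F ∈ 𝓕, F ⊆ M

end MakerBreaker

/-! ### Arboricity and the two games -/

namespace SimpleGraph

/-- The edges of `G` are partitioned into the edge sets of the forests `F 0, …, F (n - 1)`. -/
structure IsForestPartition {V : Type*} (G : SimpleGraph V) {n : ℕ}
    (F : Fin n → SimpleGraph V) : Prop where
  isAcyclic : ∀ i, (F i).IsAcyclic
  disjoint : ∀ i j, i ≠ j → Disjoint (F i).edgeSet (F j).edgeSet
  union : (⋃ i, (F i).edgeSet) = G.edgeSet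

/-- The minimum number of forests into which the edges of the (finite) graph `G` can be
partitioned. -/
noncomputable def arboricity {V : Type*} (G : SimpleGraph V) : ℕ :=
  sInf {n : ℕ | ∃ F : Fin n → SimpleGraph V, G.IsForestPartition F}

/-- The edge sets of the cycles of `G`. -/
def cycleEdgeSets {V : Type*} (G : SimpleGraph V) : Set (Set (Sym2 V)) :=
  {F | ∃ (v : V) (c : G.Walk v v), c.IsCycle ∧ F = {e | e ∈ c.edges}}

/-- Maker wins the arboricity-`k` game on `G`: she can ensure that the graph formed by her edges at
the end of the game has arboricity at least `k`. -/
def MakerWinsArboricityGame {V : Type*} (G : SimpleGraph V) (k : ℕ) : Prop :=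
  MakerBreaker.MakerWins G.edgeSet (fun M => k ≤ (fromEdgeSet M).arboricity)

/-- Maker wins the cycle game on `G`: she can ensure to claim all the edges of a cycle of `G`. -/
def MakerWinsCycleGame {V : Type*} (G : SimpleGraph V) : Prop :=
  MakerBreaker.MakerWins G.edgeSet (MakerBreaker.ClaimsSome G.cycleEdgeSets)

end SimpleGraph

/-! ### Random access machines and polynomial time

The machine has registers and an infinite memory, all cells holding natural numbers. The only
arithmetic is addition and truncated subtraction, and memory is addressed indirectly. Every
instruction and every test takes one step. Since there is no multiplication, numbers grow by at
most one bit per step, so that polynomial time in this model is polynomial time on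
Turing machines. -/

namespace RAM

structure State where
  reg : ℕ → ℕ
  mem : ℕ → ℕ

namespace State

def setReg (s : State) (r v : ℕ) : State := ⟨Function.update s.reg r v, s.mem⟩

def setMem (s : State) (a v : ℕ) : State := ⟨s.reg, Function.update s.mem a v⟩

end State

/-- Programs. The natural numbers in an instruction are names of registers, except for the
constant `c` in `const r c`. -/
inductive Program where
  /-- `r := c` -/
  | const (r c : ℕ)
  /-- `r := a + b` -/
  | add (r a b : ℕ)
  /-- `r := a - b` (and `0` if `a < b`) -/
  | sub (r a b : ℕ)
  /-- `r := mem[a]` -/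
  | load (r a : ℕ)
  /-- `mem[a] := r` -/
  | store (a r : ℕ)
  /-- first `p`, then `q` -/
  | seq (p q : Program)
  /-- if `r ≠ 0` then `p` else `q` -/
  | ite (r : ℕ) (p q : Program)
  /-- while `r ≠ 0` do `p` -/
  | loop (r : ℕ) (p : Program)

/-- `Runs p s t s'`: started in the state `s`, the program `p` halts after exactly `t` steps in the
state `s'`. -/
inductive Runs : Program → State → ℕ → State → Prop
  | const (r c : ℕ) (s : State) : Runs (.const r c) s 1 (s.setReg r c)
  | add (r a b : ℕ) (s : State) : Runs (.add r a b) s 1 (s.setReg r (s.reg a + s.reg b))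
  | sub (r a b : ℕ) (s : State) : Runs (.sub r a b) s 1 (s.setReg r (s.reg a - s.reg b))
  | load (r a : ℕ) (s : State) : Runs (.load r a) s 1 (s.setReg r (s.mem (s.reg a)))
  | store (a r : ℕ) (s : State) : Runs (.store a r) s 1 (s.setMem (s.reg a) (s.reg r))
  | seq {p q : Program} {s s₁ s₂ : State} {t₁ t₂ : ℕ}
      (h₁ : Runs p s t₁ s₁) (h₂ : Runs q s₁ t₂ s₂) : Runs (.seq p q) s (t₁ + t₂) s₂
  | ite_true {r : ℕ} {p q : Program} {s s₁ : State} {t : ℕ}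
      (hr : s.reg r ≠ 0) (h : Runs p s t s₁) : Runs (.ite r p q) s (t + 1) s₁
  | ite_false {r : ℕ} {p q : Program} {s s₁ : State} {t : ℕ}
      (hr : s.reg r = 0) (h : Runs q s t s₁) : Runs (.ite r p q) s (t + 1) s₁
  | loop_stop {r : ℕ} {p : Program} {s : State}
      (hr : s.reg r = 0) : Runs (.loop r p) s 1 s
  | loop_step {r : ℕ} {p : Program} {s s₁ s₂ : State} {t₁ t₂ : ℕ}
      (hr : s.reg r ≠ 0) (h₁ : Runs p s t₁ s₁) (h₂ : Runs (.loop r p) s₁ t₂ s₂) :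
      Runs (.loop r p) s (t₁ + t₂ + 1) s₂

/-- The model is deterministic. -/
theorem Runs.unique {p : Program} {s s₁ s₂ : State} {t₁ t₂ : ℕ}
    (h₁ : Runs p s t₁ s₁) (h₂ : Runs p s t₂ s₂) : t₁ = t₂ ∧ s₁ = s₂ := by
  induction h₁ generalizing t₂ s₂ with
  | const | add | sub | load | store => cases h₂; exact ⟨rfl, rfl⟩
  | seq _ _ ih₁ ih₂ =>
    cases h₂ with
    | seq g₁ g₂ =>
      obtain ⟨rfl, rfl⟩ := ih₁ g₁
      obtain ⟨rfl, rfl⟩ := ih₂ g₂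
      exact ⟨rfl, rfl⟩
  | ite_true hr _ ih =>
    cases h₂ with
    | ite_true _ g =>
      obtain ⟨rfl, rfl⟩ := ih g
      exact ⟨rfl, rfl⟩
    | ite_false hr' _ => exact absurd hr' hr
  | ite_false hr _ ih =>
    cases h₂ with
    | ite_true hr' _ => exact absurd hr hr'
    | ite_false _ g =>
      obtain ⟨rfl, rfl⟩ := ih g
      exact ⟨rfl, rfl⟩
  | loop_stop hr =>
    cases h₂ with
    | loop_stop _ => exact ⟨rfl, rfl⟩
    | loop_step hr' _ _ => exact absurd hr hr'
  | loop_step hr _ _ ih₁ ih₂ =>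
    cases h₂ with
    | loop_stop hr' => exact absurd hr' hr
    | loop_step _ g₁ g₂ =>
      obtain ⟨rfl, rfl⟩ := ih₁ g₁
      obtain ⟨rfl, rfl⟩ := ih₂ g₂
      exact ⟨rfl, rfl⟩

/-- The initial state on the input word `w`: the word stands in the memory cells
`0, …, w.length - 1`, and all other cells and all registers are `0`. -/
def initState (w : List ℕ) : State := ⟨fun _ => 0, fun i => w.getD i 0⟩

/-- The length of the input in bits, with one separator symbol per number. -/
def inputSize (w : List ℕ) : ℕ := (w.map fun a => Nat.size a + 1).sum

/-- The decision problem `P`, whose instances are presented by `encode`, is decidable in polynomial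
time: a single program halts on every instance within a number of steps that is polynomial in the
size of the encoded instance, with `1` in register `0` if the answer is yes and `0` if it is no. -/
def DecidableInPolyTime {α : Type*} (encode : α → List ℕ) (P : α → Prop) : Prop :=
  ∃ (p : Program) (T : Polynomial ℕ), ∀ a : α, ∃ (t : ℕ) (s : State),
    Runs p (initState (encode a)) t s ∧ t ≤ T.eval (inputSize (encode a)) ∧
      (P a → s.reg 0 = 1) ∧ (¬ P a → s.reg 0 = 0)

end RAM

/-! ### The decision problem -/

/-- A graph with vertex set `{0, …, n - 1}`, together with an integer `k ≥ 0`. -/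
structure ArboricityGameInstance where
  n : ℕ
  G : SimpleGraph (Fin n)
  k : ℕ

namespace ArboricityGameInstance

open Classical in
/-- The number of vertices, the integer `k`, and the rows of the adjacency matrix. -/
noncomputable def encode (I : ArboricityGameInstance) : List ℕ :=
  I.n :: I.k ::
    (List.finRange I.n).flatMap fun i =>
      (List.finRange I.n).map fun j => if I.G.Adj i j then 1 else 0

end ArboricityGameInstance

/-!
Write `ar` for the arboricity. Both bounds for the game come from decompositions of the edge set.

*Breaker.* If the edges of `G` split into `2 m` forests, pair the forests. Breaker plays on each
pair the reply that Lehman found for the Shannon switching game: Maker's edges in a pair together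
with the unclaimed edges of either forest of the pair stay acyclic, because an edge which Maker
takes from one forest can only close a cycle in the other one, and Breaker destroys this cycle by
claiming an edge of it (`isAcyclic_insert_or_exchange`, `PairingInvariant.exists_reply`). So Maker
ends with at most `m` forests. *Maker.* Since `ar` is subadditive over the two final edge sets, one
of the players ends with arboricity at least `ar G / 2`, and by determinacy and strategy stealing
the first player can be that player (`makerWins_of_forall_or`). Together, Maker wins if and only if
`k = 0` or `G` does not split into `2 (k - 1)` forests
(`makerWinsArboricityGame_iff_two_mul`).

*Complexity.* It remains to decide in polynomial time whether `ar G ≤ m`. By the theorem of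
Nash-Williams (`arboricity_le_iff_dartCount`) this means that every nonempty vertex set `U` spans at
most `m (|U| - 1)` edges. The nontrivial direction of that theorem is an instance of Rado's theorem
for the rank function of the graphic matroid (`exists_coloring_of_card_le_mul`), the rank being the
dimension of the span of incidence vectors.

The counting condition is tested by load balancing. Every edge carries `2 N` tokens, `N = n ^ 2`,
which it shares between its ends; one vertex `r` is given an extra load `D = 2 N m`. Tokens
are moved along edges from larger to smaller loads as long as the sum of the squares of the loads
decreases. If the counting condition holds, then in the resulting distribution all loads are below
`D + n` (`IsTokenDistribution.load_lt`); conversely, if all loads are below `D + n`, then the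
counting condition holds for all `U` that contain `r` (`IsTokenDistribution.dartCount_le`), because
`N` is large enough to make the rounding error harmless. For `k > n` Maker loses anyway, so `D` may
be assumed to be polynomial in `n`, and the sum of squares bounds the number of moves.
-/

/-! ### Arboricity as a colouring number -/

namespace SimpleGraph

variable {V : Type*}

/-- A colouring of the edges by natural numbers below `n` without monochromatic cycle. This is a
partition into `n` forests, but colours are easier to merge and split than indexed families. -/
def IsForestColoring (S : Set (Sym2 V)) (n : ℕ) (c : Sym2 V → ℕ) : Prop :=
  (∀ e ∈ S, c e < n) ∧ ∀ i, (fromEdgeSet {e | e ∈ S ∧ c e = i}).IsAcyclic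

theorem exists_isForestPartition_iff (G : SimpleGraph V) (n : ℕ) :
    (∃ F : Fin n → SimpleGraph V, G.IsForestPartition F) ↔
      ∃ c, IsForestColoring G.edgeSet n c := by
  classical
  constructor
  · rintro ⟨F, hF⟩
    have key : ∀ e ∈ G.edgeSet, ∃ i : Fin n, e ∈ (F i).edgeSet := fun e he => by
      rw [← hF.union] at he
      simpa using he
    choose g hg using key
    refine ⟨fun e => if h : e ∈ G.edgeSet then (g e h : ℕ) else 0, ?_, ?_⟩
    · intro e he
      simp [he]
    · intro i
      by_cases hi : i < n
      · refine (hF.isAcyclic ⟨i, hi⟩).anti ?_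
        intro u v huv
        obtain ⟨⟨h1, h2⟩, -⟩ := (fromEdgeSet_adj _).1 huv
        simp only [dif_pos h1] at h2
        have h3 := hg _ h1
        rwa [show g s(u, v) h1 = ⟨i, hi⟩ from Fin.ext h2] at h3
      · refine (isAcyclic_bot).anti ?_
        intro u v huv
        obtain ⟨⟨h1, h2⟩, -⟩ := (fromEdgeSet_adj _).1 huv
        simp only [dif_pos h1] at h2
        exact absurd (h2 ▸ (g _ h1).2) hi
  · rintro ⟨c, hc, hc'⟩
    have hmem : ∀ (i : ℕ) e, e ∈ (fromEdgeSet {e | e ∈ G.edgeSet ∧ c e = i}).edgeSet ↔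
        e ∈ G.edgeSet ∧ c e = i := by
      intro i e
      rw [edgeSet_fromEdgeSet]
      exact ⟨fun h => h.1, fun h => ⟨h, fun hd => G.not_isDiag_of_mem_edgeSet h.1 hd⟩⟩
    refine ⟨fun i => fromEdgeSet {e | e ∈ G.edgeSet ∧ c e = i}, fun i => hc' i, ?_, ?_⟩
    · intro i j hij
      refine Set.disjoint_left.2 fun e he he' => hij (Fin.ext ?_)
      rw [hmem] at he he'
      rw [← he.2, he'.2]
    · ext e
      simp only [Set.mem_iUnion, hmem]
      exact ⟨fun ⟨_, h, _⟩ => h, fun h => ⟨⟨c e, hc e h⟩, h, rfl⟩⟩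

theorem IsForestColoring.mono {S : Set (Sym2 V)} {n n' : ℕ} {c : Sym2 V → ℕ}
    (h : IsForestColoring S n c) (hn : n ≤ n') : IsForestColoring S n' c :=
  ⟨fun e he => (h.1 e he).trans_le hn, h.2⟩

theorem isAcyclic_of_subset {S T : Set (Sym2 V)} (h : S ⊆ T) (hT : (fromEdgeSet T).IsAcyclic) :
    (fromEdgeSet S).IsAcyclic :=
  hT.anti (fromEdgeSet_mono h)

theorem isAcyclic_fromEdgeSet_singleton (e : Sym2 V) : (fromEdgeSet {e}).IsAcyclic := by
  induction e with
  | h u v =>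
    have h : (⊥ ⊔ edge u v : SimpleGraph V).IsAcyclic :=
      isAcyclic_sup_fromEdgeSet_iff.2 ⟨isAcyclic_bot, fun h => Or.inl (by simpa using h)⟩
    simpa [edge] using h

theorem exists_isForestColoring [Finite V] (S : Set (Sym2 V)) :
    ∃ n c, IsForestColoring S n c := by
  have : Finite (Sym2 V) := inferInstance
  let φ := Finite.equivFin (Sym2 V)
  refine ⟨Nat.card (Sym2 V), fun e => φ e, fun e _ => (φ e).2, fun i => ?_⟩
  by_cases hi : i < Nat.card (Sym2 V)
  · refine isAcyclic_of_subset ?_ (isAcyclic_fromEdgeSet_singleton (φ.symm ⟨i, hi⟩))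
    rintro e ⟨-, he⟩
    rw [Set.mem_singleton_iff, Equiv.eq_symm_apply]
    exact Fin.ext he
  · refine isAcyclic_of_subset (T := ∅) ?_ (by simp)
    rintro e ⟨-, he⟩
    exact absurd (he ▸ (φ e).2) hi

/-- On a finite graph the infimum that defines the arboricity is attained. -/
theorem arboricity_le_iff [Finite V] (G : SimpleGraph V) (n : ℕ) :
    G.arboricity ≤ n ↔ ∃ c, IsForestColoring G.edgeSet n c := by
  simp only [arboricity, exists_isForestPartition_iff]
  constructor
  · intro h
    obtain ⟨c, hc⟩ := Nat.sInf_mem (s := {n | ∃ c, IsForestColoring G.edgeSet n c})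
      (exists_isForestColoring _)
    exact ⟨c, hc.mono h⟩
  · intro h
    exact Nat.sInf_le h

theorem edgeSet_fromEdgeSet_of_subset {G : SimpleGraph V} {M : Set (Sym2 V)}
    (h : M ⊆ G.edgeSet) : (fromEdgeSet M).edgeSet = M := by
  rw [edgeSet_fromEdgeSet]
  exact sdiff_eq_left.2 (Set.disjoint_left.2 fun e he hd =>
    G.not_isDiag_of_mem_edgeSet (h he) hd)

theorem arboricity_fromEdgeSet_le_iff [Finite V] {G : SimpleGraph V} {M : Set (Sym2 V)}
    (h : M ⊆ G.edgeSet) (n : ℕ) :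
    (fromEdgeSet M).arboricity ≤ n ↔ ∃ c, IsForestColoring M n c := by
  rw [arboricity_le_iff, edgeSet_fromEdgeSet_of_subset h]

theorem arboricity_mono [Finite V] {G H : SimpleGraph V} (h : G ≤ H) :
    G.arboricity ≤ H.arboricity := by
  obtain ⟨c, hc, hc'⟩ := (arboricity_le_iff H _).1 le_rfl
  exact (arboricity_le_iff _ _).2 ⟨c, fun e he => hc e (edgeSet_mono h he),
    fun i => isAcyclic_of_subset (by exact fun e he => ⟨edgeSet_mono h he.1, he.2⟩) (hc' i)⟩

/-- Arboricity is subadditive: use disjoint sets of colours for the two parts. -/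
theorem arboricity_le_add [Finite V] {G : SimpleGraph V} {M : Set (Sym2 V)}
    (hM : M ⊆ G.edgeSet) :
    G.arboricity ≤ (fromEdgeSet M).arboricity + (fromEdgeSet (G.edgeSet \ M)).arboricity := by
  classical
  obtain ⟨c, hc, hc'⟩ := (arboricity_fromEdgeSet_le_iff hM _).1 le_rfl
  obtain ⟨d, hd, hd'⟩ := (arboricity_fromEdgeSet_le_iff (M := G.edgeSet \ M)
    Set.sdiff_subset _).1 le_rfl
  set a := (fromEdgeSet M).arboricity
  set b := (fromEdgeSet (G.edgeSet \ M)).arboricity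
  refine (arboricity_le_iff _ _).2 ⟨fun e => if e ∈ M then c e else a + d e, ?_, ?_⟩
  · intro e he
    by_cases h : e ∈ M
    · simpa [h] using (hc e h).trans_le (Nat.le_add_right a b)
    · simpa [h] using hd e ⟨he, h⟩
  · intro i
    by_cases hi : i < a
    · refine isAcyclic_of_subset ?_ (hc' i)
      rintro e ⟨he, h⟩
      by_cases heM : e ∈ M
      · exact ⟨heM, by simpa [heM] using h⟩
      · simp only [heM, if_false] at h
        omega
    · refine isAcyclic_of_subset ?_ (hd' (i - a))
      rintro e ⟨he, h⟩
      by_cases heM : e ∈ M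
      · simp only [heM, if_true] at h
        have := hc e heM
        omega
      · simp only [heM, if_false] at h
        exact ⟨⟨he, heM⟩, by omega⟩

/-- The exchange property on which Breaker's strategy rests: if `K ∪ Q` and `insert e K` are
forests, then adding `e` to `K ∪ Q` leaves a forest after the removal of some edge of `Q \ K`,
unless no removal is needed. -/
theorem isAcyclic_insert_or_exchange {K Q : Set (Sym2 V)} {e : Sym2 V}
    (hKQ : (fromEdgeSet (K ∪ Q)).IsAcyclic) (heK : (fromEdgeSet (insert e K)).IsAcyclic) :
    (fromEdgeSet (insert e (K ∪ Q))).IsAcyclic ∨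
      ∃ f ∈ Q \ K, (fromEdgeSet (insert e ((K ∪ Q) \ {f}))).IsAcyclic := by
  induction e with
  | h u v =>
  have ins : ∀ S : Set (Sym2 V), fromEdgeSet (insert s(u, v) S) = fromEdgeSet S ⊔ edge u v := by
    intro S
    rw [edge, ← fromEdgeSet_union, Set.union_singleton]
  rw [ins] at heK
  simp only [ins]
  by_cases hr : (fromEdgeSet (K ∪ Q)).Reachable u v
  · by_cases huv : u = v
    · left
      subst huv
      simpa using hKQ
    by_cases hin : s(u, v) ∈ K ∪ Q
    · left
      refine hKQ.anti (sup_le le_rfl ?_)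
      exact fromEdgeSet_mono (by simpa using hin)
    right
    obtain ⟨p, hp⟩ := hr.exists_isPath
    -- the cycle closed by `e` cannot consist of edges of `K` alone
    have hex : ∃ f ∈ p.edges, f ∉ K := by
      by_contra! hall
      have hreach : (fromEdgeSet K).Reachable u v := by
        refine ⟨p.transfer _ fun f hf => ?_⟩
        have := p.edges_subset_edgeSet hf
        rw [edgeSet_fromEdgeSet] at this ⊢
        exact ⟨hall f hf, this.2⟩
      rcases (isAcyclic_sup_fromEdgeSet_iff.1 heK).2 hreach with h | h
      · exact huv h
      · exact hin (Or.inl ((fromEdgeSet_adj _).1 h).1)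
    obtain ⟨f, hfp, hfK⟩ := hex
    have hfQ : f ∈ Q := by
      have := p.edges_subset_edgeSet hfp
      rw [edgeSet_fromEdgeSet] at this
      exact this.1.resolve_left hfK
    have hle : fromEdgeSet ((K ∪ Q) \ {f}) ≤ fromEdgeSet (K ∪ Q) :=
      fromEdgeSet_mono Set.sdiff_subset
    refine ⟨f, ⟨hfQ, hfK⟩, IsAcyclic.sup_edge_of_not_reachable ?_ (hKQ.anti hle)⟩
    intro hr'
    obtain ⟨p', hp'⟩ := hr'.exists_isPath
    have heq := (hKQ.subsingleton_path u v).elim ⟨p, hp⟩ ⟨p'.mapLe hle, hp'.mapLe hle⟩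
    have hpp : p = p'.mapLe hle := congrArg Subtype.val heq
    rw [hpp, Walk.edges_mapLe_eq_edges] at hfp
    have := p'.edges_subset_edgeSet hfp
    rw [edgeSet_fromEdgeSet] at this
    exact this.1.2 rfl
  · exact Or.inl (hKQ.sup_edge_of_not_reachable hr)

end SimpleGraph

/-! ### Maker-Breaker games: determinacy and strategy stealing -/

namespace MakerBreaker

variable {X : Type*} {W W' : Set X → Prop}

/-- Only the values of the winning condition on subsets of the board matter. -/
theorem MakerWinsFrom.congr {E : Set X} (hW : ∀ M ⊆ E, W M → W' M) {p : Player} {M U : Set X}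
    (h : MakerWinsFrom W p M U) (hM : M ⊆ E) (hU : U ⊆ E) : MakerWinsFrom W' p M U := by
  induction h with
  | finished p M h => exact .finished p M (hW M hM h)
  | makerMove M U e he _ ih =>
    exact .makerMove M U e he (ih (Set.insert_subset (hU he) hM) (Set.sdiff_subset.trans hU))
  | breakerMove M U hne _ ih =>
    exact .breakerMove M U hne fun e he => ih e he hM (Set.sdiff_subset.trans hU)

theorem MakerWinsFrom.of_empty {p : Player} {M : Set X} (h : MakerWinsFrom W p M ∅) : W M := by
  cases h with
  | finished _ _ h => exact h
  | makerMove _ _ e he _ => exact absurd he (Set.notMem_empty e)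
  | breakerMove _ _ hU _ => exact absurd hU Set.not_nonempty_empty

theorem MakerWinsFrom.of_breaker {M U : Set X} (h : MakerWinsFrom W .breaker M U) {e : X}
    (he : e ∈ U) : MakerWinsFrom W .maker M (U \ {e}) := by
  cases h with
  | finished _ _ _ => exact absurd he (Set.notMem_empty e)
  | breakerMove _ _ _ h => exact h e he

theorem ncard_diff_singleton_eq [Finite X] {U : Set X} {e : X} (he : e ∈ U) {n : ℕ}
    (hn : U.ncard = n + 1) : (U \ {e}).ncard = n := by
  rw [Set.ncard_sdiff_singleton_of_mem he, hn, Nat.add_sub_cancel]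

/-- For a monotone winning condition, neither an extra element nor an extra move hurts Maker. The
two facts are proved together by induction on the number of unclaimed elements. -/
theorem extra_move [Finite X] (hW : ∀ M M', M ⊆ M' → W M → W M') (n : ℕ) :
    (∀ M U p e, U.ncard = n → e ∈ U → MakerWinsFrom W p M U →
      MakerWinsFrom W p (insert e M) (U \ {e})) ∧
    (∀ M U, U.ncard = n → MakerWinsFrom W .breaker M U → MakerWinsFrom W .maker M U) := by
  induction n with
  | zero =>
    refine ⟨fun M U p e hU he _ => ?_, fun M U hU h => ?_⟩
    · rw [(Set.ncard_eq_zero).1 hU] at he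
      exact absurd he (Set.notMem_empty e)
    · rw [(Set.ncard_eq_zero).1 hU] at h ⊢
      exact .finished _ _ h.of_empty
  | succ n ih =>
    have first : ∀ M U p e, U.ncard = n + 1 → e ∈ U → MakerWinsFrom W p M U →
        MakerWinsFrom W p (insert e M) (U \ {e}) := by
      intro M U p e hU he h
      cases h with
      | finished _ _ _ => exact absurd he (Set.notMem_empty e)
      | makerMove _ _ f hf h =>
        by_cases hef : e = f
        · subst hef
          exact ih.2 _ _ (ncard_diff_singleton_eq he hU) h
        · refine .makerMove _ _ f ⟨hf, fun h => hef h.symm⟩ ?_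
          have := ih.1 _ _ _ e (ncard_diff_singleton_eq hf hU) ⟨he, hef⟩ h
          rwa [Set.insert_comm, Set.sdiff_sdiff_comm] at this
      | breakerMove _ _ hne h =>
        rcases (U \ {e}).eq_empty_or_nonempty with hemp | hne'
        · have h1 := h e he
          rw [hemp] at h1 ⊢
          exact .finished _ _ (hW _ _ (Set.subset_insert e M) h1.of_empty)
        · refine .breakerMove _ _ hne' fun f hf => ?_
          have := ih.1 _ _ _ e (ncard_diff_singleton_eq hf.1 hU) ⟨he, fun h => hf.2 h.symm⟩
            (h f hf.1)
          rwa [Set.sdiff_sdiff_comm] at this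
    refine ⟨first, fun M U hU h => ?_⟩
    obtain ⟨e, he⟩ : U.Nonempty := (Set.ncard_pos).1 (by omega)
    exact .makerMove _ _ e he (first _ _ _ e hU he h)

/-- Determinacy: if Maker does not win, then the other player can enforce the complementary
condition on his own final set. The roles of the players are exchanged in the conclusion. -/
theorem determined [Finite X] {E : Set X} (n : ℕ) : ∀ (M B U : Set X), U.ncard = n →
    E \ (M ∪ U) = B → B ⊆ E → Disjoint B U → U ⊆ E → M ⊆ E → Disjoint M U →
    (¬ MakerWinsFrom W .maker M U →
      MakerWinsFrom (fun B => ¬ W (E \ B)) .breaker B U) ∧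
    (¬ MakerWinsFrom W .breaker M U →
      MakerWinsFrom (fun B => ¬ W (E \ B)) .maker B U) := by
  induction n with
  | zero =>
    intro M B U hU hB _ _ _ hM _
    obtain rfl := (Set.ncard_eq_zero).1 hU
    have hBM : E \ B = M := by
      rw [← hB, Set.union_empty, Set.sdiff_sdiff_cancel_left hM]
    refine ⟨fun h => .finished _ _ ?_, fun h => .finished _ _ ?_⟩ <;>
    · rw [hBM]
      exact fun hw => h (.finished _ _ hw)
  | succ n ih =>
    intro M B U hU hB hBE hBU hUE hME hMU
    have hne : U.Nonempty := (Set.ncard_pos).1 (by omega)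
    constructor
    · intro h
      refine .breakerMove _ _ hne fun e he => ?_
      refine (ih (insert e M) B (U \ {e}) (ncard_diff_singleton_eq he hU) ?_ hBE
        (hBU.mono_right Set.sdiff_subset) (Set.sdiff_subset.trans hUE)
        (Set.insert_subset (hUE he) hME) ?_).2 fun h' => h (.makerMove _ _ e he h')
      · rw [← hB]
        congr 1
        ext x
        by_cases hx : x = e <;> simp [hx, he]
      · rw [Set.disjoint_left] at hMU ⊢
        rintro x (rfl | hx) hxU
        · exact hxU.2 rfl
        · exact hMU hx hxU.1
    · intro h
      have : ∃ e ∈ U, ¬ MakerWinsFrom W .maker M (U \ {e}) := by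
        by_contra! hall
        exact h (.breakerMove _ _ hne hall)
      obtain ⟨e, he, h'⟩ := this
      refine .makerMove _ _ e he ((ih M (insert e B) (U \ {e}) (ncard_diff_singleton_eq he hU) ?_
        (Set.insert_subset (hUE he) hBE) ?_ (Set.sdiff_subset.trans hUE) hME
        (hMU.mono_right Set.sdiff_subset)).1 h')
      · rw [← hB]
        ext x
        by_cases hx : x = e
        · subst hx
          simp [hUE he, Set.disjoint_right.1 hMU he]
        · simp [hx]
      · rw [Set.disjoint_left] at hBU ⊢
        rintro x (rfl | hx) hxU
        · exact hxU.2 rfl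
        · exact hBU hx hxU.1

/-- Strategy stealing: if for every partition of the board into two sets one of the two parts
satisfies the monotone condition `W`, then the first player can claim such a part. -/
theorem makerWins_of_forall_or [Finite X] {E : Set X} (hW : ∀ M M', M ⊆ M' → W M → W M')
    (h : ∀ B ⊆ E, W B ∨ W (E \ B)) : MakerWins E W := by
  by_contra hno
  have h1 := (determined (W := W) (E := E) _ ∅ ∅ E rfl (by simp) (Set.empty_subset _)
    (Set.empty_disjoint _) le_rfl (Set.empty_subset _) (Set.empty_disjoint _)).1 hno
  have h2 : MakerWinsFrom W .breaker ∅ E :=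
    h1.congr (fun B hB hw => (h B hB).resolve_right hw) (Set.empty_subset _) le_rfl
  exact hno ((extra_move hW _).2 _ _ rfl h2)

end MakerBreaker

/-! ### The outcome of the arboricity game -/

namespace SimpleGraph

open MakerBreaker

variable {V : Type*}

/-- Breaker's invariant, for forests paired as `2 i`, `2 i + 1`: Maker's edges of both colours of a
pair together with the unclaimed edges of either one of the two colours form a forest. -/
def PairingInvariant (c : Sym2 V → ℕ) (M U : Set (Sym2 V)) : Prop :=
  ∀ j, (fromEdgeSet ({e | e ∈ M ∧ c e / 2 = j / 2} ∪ {e | e ∈ U ∧ c e = j})).IsAcyclic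

/-- Breaker can answer each move of Maker so that the invariant is restored: after Maker has
claimed an edge of one forest of a pair, only the other forest of the pair can be damaged, and
deleting one of its unclaimed edges repairs it. -/
theorem PairingInvariant.exists_reply {c : Sym2 V → ℕ} {M U : Set (Sym2 V)} {e : Sym2 V}
    (h : PairingInvariant c M U) (he : e ∈ U) (hne : (U \ {e}).Nonempty) :
    ∃ f ∈ U \ {e}, PairingInvariant c (insert e M) ((U \ {e}) \ {f}) := by
  -- `j` is the colour paired with the colour of `e`
  obtain ⟨j, hj, hj2⟩ : ∃ j, j ≠ c e ∧ j / 2 = c e / 2 := by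
    rcases Nat.mod_two_eq_zero_or_one (c e) with h | h
    · exact ⟨c e + 1, by omega, by omega⟩
    · exact ⟨c e - 1, by omega, by omega⟩
  have hKQ := h j
  have heK : (fromEdgeSet (insert e {x | x ∈ M ∧ c x / 2 = j / 2})).IsAcyclic := by
    refine isAcyclic_of_subset ?_ (h (c e))
    rintro x (rfl | hx)
    · exact Or.inr ⟨he, rfl⟩
    · exact Or.inl ⟨hx.1, by rw [hx.2, hj2]⟩
  have other : ∀ f, ∀ i, i ≠ j → (fromEdgeSet ({x | x ∈ insert e M ∧ c x / 2 = i / 2} ∪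
      {x | x ∈ (U \ {e}) \ {f} ∧ c x = i})).IsAcyclic := by
    intro f i hi
    refine isAcyclic_of_subset ?_ (h i)
    rintro x (⟨rfl | hx, hx2⟩ | hx)
    · exact Or.inr ⟨he, by omega⟩
    · exact Or.inl ⟨hx, hx2⟩
    · exact Or.inr ⟨hx.1.1.1, hx.2⟩
  rcases isAcyclic_insert_or_exchange hKQ heK with hA | ⟨f, hf, hA⟩
  · obtain ⟨f, hf⟩ := hne
    refine ⟨f, hf, fun i => ?_⟩
    by_cases hi : i = j
    · subst hi
      refine isAcyclic_of_subset ?_ hA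
      rintro x (⟨rfl | hx, hx2⟩ | hx)
      · exact Or.inl rfl
      · exact Or.inr (Or.inl ⟨hx, hx2⟩)
      · exact Or.inr (Or.inr ⟨hx.1.1.1, hx.2⟩)
    · exact other f i hi
  · refine ⟨f, ⟨hf.1.1, ?_⟩, fun i => ?_⟩
    · rintro rfl
      exact hj hf.1.2.symm
    by_cases hi : i = j
    · subst hi
      refine isAcyclic_of_subset ?_ hA
      rintro x (⟨rfl | hx, hx2⟩ | hx)
      · exact Or.inl rfl
      · refine Or.inr ⟨Or.inl ⟨hx, hx2⟩, ?_⟩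
        rintro rfl
        exact hf.2 ⟨hx, hx2⟩
      · exact Or.inr ⟨Or.inr ⟨hx.1.1.1, hx.2⟩, hx.1.2⟩
    · exact other f i hi

theorem PairingInvariant.isForestColoring {c : Sym2 V → ℕ} {M : Set (Sym2 V)} {m : ℕ}
    (h : PairingInvariant c M ∅) (hc : ∀ e ∈ M, c e < 2 * m) :
    IsForestColoring M m fun e => c e / 2 := by
  refine ⟨fun e he => ?_, fun i => isAcyclic_of_subset ?_ (h (2 * i))⟩
  · have := hc e he
    simp only
    omega
  · rintro e ⟨he, h2⟩
    refine Or.inl ⟨he, ?_⟩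
    simp only at h2
    omega

/-- From a position in which the invariant holds, Breaker keeps the arboricity of Maker's graph
down to the number of pairs. -/
theorem le_of_makerWinsFrom_of_pairingInvariant [Finite V] {G : SimpleGraph V} {c : Sym2 V → ℕ}
    {k m : ℕ} (hc : ∀ e ∈ G.edgeSet, c e < 2 * m) (n : ℕ) : ∀ M U : Set (Sym2 V), U.ncard = n →
      M ⊆ G.edgeSet → U ⊆ G.edgeSet → PairingInvariant c M U →
      MakerWinsFrom (fun M => k ≤ (fromEdgeSet M).arboricity) .maker M U → k ≤ m := by
  have done : ∀ M : Set (Sym2 V), M ⊆ G.edgeSet → PairingInvariant c M ∅ →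
      k ≤ (fromEdgeSet M).arboricity → k ≤ m := fun M hM hinv hk =>
    hk.trans ((arboricity_fromEdgeSet_le_iff hM m).2
      ⟨_, hinv.isForestColoring fun e he => hc e (hM he)⟩)
  induction n using Nat.strong_induction_on with
  | _ n ih =>
  intro M U hn hM hU hinv hwin
  cases hwin with
  | finished _ _ hk => exact done M hM hinv hk
  | makerMove _ _ e he h =>
    have hM' : insert e M ⊆ G.edgeSet := Set.insert_subset (hU he) hM
    rcases (U \ {e}).eq_empty_or_nonempty with hemp | hne
    · rw [hemp] at h
      refine done _ hM' (fun j => ?_) h.of_empty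
      by_cases hj : c e / 2 = j / 2
      · refine isAcyclic_of_subset ?_ (hinv (c e))
        rintro x (⟨rfl | hx, hx2⟩ | hx)
        · exact Or.inr ⟨he, rfl⟩
        · exact Or.inl ⟨hx, by omega⟩
        · exact absurd hx.1 (Set.notMem_empty x)
      · refine isAcyclic_of_subset ?_ (hinv j)
        rintro x (⟨rfl | hx, hx2⟩ | hx)
        · exact absurd hx2 hj
        · exact Or.inl ⟨hx, hx2⟩
        · exact absurd hx.1 (Set.notMem_empty x)
    · obtain ⟨f, hf, hinv'⟩ := hinv.exists_reply he hne
      refine ih _ ?_ _ _ rfl hM' ((Set.sdiff_subset.trans Set.sdiff_subset).trans hU) hinv'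
        (h.of_breaker hf)
      rw [← hn]
      exact (Set.ncard_sdiff_singleton_lt_of_mem hf).trans (Set.ncard_sdiff_singleton_lt_of_mem he)

theorem makerWinsArboricityGame_iff_two_mul [Finite V] (G : SimpleGraph V) (k : ℕ) :
    G.MakerWinsArboricityGame k ↔ k = 0 ∨ ¬ G.arboricity ≤ 2 * (k - 1) := by
  constructor
  · intro h
    by_contra! hk
    obtain ⟨c, hc, hc'⟩ := (arboricity_le_iff _ _).1 hk.2
    have := le_of_makerWinsFrom_of_pairingInvariant hc _ ∅ G.edgeSet rfl (Set.empty_subset _)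
      le_rfl (fun j => isAcyclic_of_subset (T := {e | e ∈ G.edgeSet ∧ c e = j}) (by simp) (hc' j)) h
    omega
  · intro hk
    refine makerWins_of_forall_or (fun M M' h hM => hM.trans (arboricity_mono (fromEdgeSet_mono h)))
      fun B hB => ?_
    have := arboricity_le_add hB
    omega

theorem makerWinsArboricityGame_iff [Finite V] (G : SimpleGraph V) (k : ℕ) :
    G.MakerWinsArboricityGame k ↔ k ≤ ⌈(G.arboricity : ℚ) / 2⌉₊ := by
  rw [makerWinsArboricityGame_iff_two_mul]
  rcases k with _ | k
  · simp
  · rw [Nat.succ_le_iff, Nat.lt_ceil, lt_div_iff₀ two_pos]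
    norm_cast
    simp
    omega

/-! ### The cycle game -/

theorem arboricity_le_one_iff [Finite V] (G : SimpleGraph V) : G.arboricity ≤ 1 ↔ G.IsAcyclic := by
  rw [arboricity_le_iff]
  constructor
  · rintro ⟨c, hc, hc'⟩
    refine (hc' 0).anti ?_
    rw [le_fromEdgeSet_iff]
    intro e he
    exact ⟨he, Nat.lt_one_iff.1 (hc e he)⟩
  · intro h
    exact ⟨fun _ => 0, fun _ _ => Nat.one_pos, fun i =>
      h.anti ((fromEdgeSet_le _).2 fun e he => he.1.1)⟩

theorem two_le_arboricity_iff [Finite V] {G : SimpleGraph V} {M : Set (Sym2 V)}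
    (hM : M ⊆ G.edgeSet) :
    2 ≤ (fromEdgeSet M).arboricity ↔ ClaimsSome G.cycleEdgeSets M := by
  have hME := edgeSet_fromEdgeSet_of_subset hM
  rw [Nat.succ_le_iff, ← not_le, arboricity_le_one_iff]
  constructor
  · intro h
    simp only [IsAcyclic, not_forall, not_not] at h
    obtain ⟨v, p, hp⟩ := h
    have hpM : ∀ e ∈ p.edges, e ∈ M := fun e he => hME ▸ p.edges_subset_edgeSet he
    have hpG : ∀ e ∈ p.edges, e ∈ G.edgeSet := fun e he => hM (hpM e he)
    exact ⟨_, ⟨v, p.transfer G hpG, hp.transfer hpG, rfl⟩, fun e he => hpM e (by simpa using he)⟩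
  · rintro ⟨_, ⟨v, p, hp, rfl⟩, hpM⟩ h
    have hpM' : ∀ e ∈ p.edges, e ∈ (fromEdgeSet M).edgeSet := fun e he => hME.symm ▸ hpM he
    exact h _ (hp.transfer hpM')

theorem makerWinsArboricityGame_two_iff [Finite V] (G : SimpleGraph V) :
    G.MakerWinsArboricityGame 2 ↔ G.MakerWinsCycleGame :=
  ⟨fun h => h.congr (fun _ hM => (two_le_arboricity_iff hM).1) (Set.empty_subset _) le_rfl,
    fun h => h.congr (fun _ hM => (two_le_arboricity_iff hM).2) (Set.empty_subset _) le_rfl⟩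

end SimpleGraph

/-! ### Covering by a submodular rank function -/

section Covering

variable {E ι : Type*} [DecidableEq E] [Fintype ι] [DecidableEq ι]

/-- A form of Rado's theorem: elements that may use any of the colours `ι` can be given at most one
colour each, so that no subset of `T` outweighs the total rank of its colour classes. As in
Welsh's proof, superfluous colours are removed one at a time, which submodularity permits. -/
theorem exists_coloring_of_card_le_mul (ρ : Finset E → ℕ) (hmono : ∀ A B, A ⊆ B → ρ A ≤ ρ B)
    (hsub : ∀ A B, ρ (A ∪ B) + ρ (A ∩ B) ≤ ρ A + ρ B) (T : Finset E)
    (hT : ∀ A ⊆ T, A.card ≤ Fintype.card ι * ρ A) :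
    ∃ C : E → Finset ι, (∀ e ∈ T, (C e).card ≤ 1) ∧
      ∀ A ⊆ T, A.card ≤ ∑ i, ρ (A.filter fun e => i ∈ C e) := by
  suffices H : ∀ (n : ℕ) (C : E → Finset ι), ∑ e ∈ T, (C e).card = n →
      (∀ A ⊆ T, A.card ≤ ∑ i, ρ (A.filter fun e => i ∈ C e)) →
      ∃ C : E → Finset ι, (∀ e ∈ T, (C e).card ≤ 1) ∧
        ∀ A ⊆ T, A.card ≤ ∑ i, ρ (A.filter fun e => i ∈ C e) from
    H _ (fun _ => Finset.univ) rfl (by simpa using hT)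
  intro n
  induction n using Nat.strong_induction_on with
  | _ n ih =>
  intro C hn hC
  by_cases hdone : ∀ e ∈ T, (C e).card ≤ 1
  · exact ⟨C, hdone, hC⟩
  push Not at hdone
  obtain ⟨e, he, hcard⟩ := hdone
  obtain ⟨x, hx, y, hy, hxy⟩ := Finset.one_lt_card.1 hcard
  by_contra hno
  -- neither `x` nor `y` can be removed from the colours of `e`
  have bad : ∀ z ∈ C e, ∃ A ⊆ T, e ∈ A ∧
      ∑ i, ρ (A.filter fun f => i ∈ Function.update C e ((C e).erase z) f) < A.card := by
    intro z hz
    by_contra! hgood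
    refine hno (ih _ ?_ (Function.update C e ((C e).erase z)) rfl fun A hA => ?_)
    · rw [← hn]
      refine Finset.sum_lt_sum (fun f _ => ?_) ⟨e, he, ?_⟩
      · by_cases hf : f = e
        · subst hf
          simpa using Finset.card_le_card (Finset.erase_subset z (C f))
        · simp [hf]
      · simpa using Finset.card_erase_lt_of_mem hz
    · by_cases heA : e ∈ A
      · exact hgood A hA heA
      · refine (hC A hA).trans (le_of_eq (Finset.sum_congr rfl fun i _ => ?_))
        congr 1
        refine Finset.filter_congr fun f hf => ?_
        rw [Function.update_of_ne (by rintro rfl; exact heA hf)]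
  obtain ⟨A, hAT, heA, hA⟩ := bad x hx
  obtain ⟨B, hBT, heB, hB⟩ := bad y hy
  have hU := hC (A ∪ B) (Finset.union_subset hAT hBT)
  have hI := hC ((A ∩ B).erase e)
    ((Finset.erase_subset _ _).trans (Finset.inter_subset_left.trans hAT))
  have hsum : ∑ i, ρ ((A ∪ B).filter fun f => i ∈ C f) +
      ∑ i, ρ (((A ∩ B).erase e).filter fun f => i ∈ C f) ≤
      ∑ i, ρ (A.filter fun f => i ∈ Function.update C e ((C e).erase x) f) +
      ∑ i, ρ (B.filter fun f => i ∈ Function.update C e ((C e).erase y) f) := by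
    rw [← Finset.sum_add_distrib, ← Finset.sum_add_distrib]
    refine Finset.sum_le_sum fun i _ => (Nat.add_le_add ?_ ?_).trans (hsub _ _)
    · refine hmono _ _ fun f hf => ?_
      simp only [Finset.mem_filter, Finset.mem_union] at hf ⊢
      by_cases hfe : f = e
      · subst hfe
        simp only [Function.update_self, Finset.mem_erase]
        by_cases hix : i = x
        · right
          exact ⟨heB, fun h => hxy (hix ▸ h), hf.2⟩
        · left
          exact ⟨heA, hix, hf.2⟩
      · simpa [Function.update_of_ne hfe, ← or_and_right] using hf
    · refine hmono _ _ fun f hf => ?_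
      simp only [Finset.mem_filter, Finset.mem_inter, Finset.mem_erase] at hf ⊢
      simp [hf]
  have hcards := Finset.card_union_add_card_inter A B
  have hee := Finset.card_erase_add_one (Finset.mem_inter.2 ⟨heA, heB⟩)
  omega

end Covering

/-! ### The Nash-Williams theorem -/

namespace SimpleGraph

variable {V : Type*} [DecidableEq V]

/-- The incidence vector of an edge, over the field with two elements so that no orientation of the
edge has to be chosen. -/
def incVec : Sym2 V → V → ZMod 2 :=
  Sym2.lift ⟨fun u v => Pi.single u 1 + Pi.single v 1, fun _ _ => add_comm _ _⟩

/-- The rank of a set of edges in the graphic matroid. -/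
noncomputable def edgeRank (A : Finset (Sym2 V)) : ℕ :=
  Module.finrank (ZMod 2) (Submodule.span (ZMod 2) (incVec '' (A : Set (Sym2 V))))

theorem single_add_single_self (v : V) : (Pi.single v 1 + Pi.single v 1 : V → ZMod 2) = 0 := by
  rw [← Pi.single_add, CharTwo.add_self_eq_zero, Pi.single_zero]

theorem single_add_single_mem_span_of_reachable {S : Set (Sym2 V)} {u v : V}
    (h : (fromEdgeSet S).Reachable u v) :
    (Pi.single u 1 + Pi.single v 1 : V → ZMod 2) ∈ Submodule.span (ZMod 2) (incVec '' S) := by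
  obtain ⟨p⟩ := h
  induction p with
  | nil => simp [single_add_single_self]
  | @cons u v w h p ih =>
    have h1 : (Pi.single u 1 + Pi.single v 1 : V → ZMod 2) ∈
        Submodule.span (ZMod 2) (incVec '' S) :=
      Submodule.subset_span ⟨s(u, v), ((fromEdgeSet_adj _).1 h).1, rfl⟩
    have h2 := Submodule.add_mem _ h1 ih
    rwa [show (Pi.single u 1 + Pi.single v 1 + (Pi.single v 1 + Pi.single w 1) : V → ZMod 2) =
      Pi.single u 1 + Pi.single w 1 + (Pi.single v 1 + Pi.single v 1) by abel,
      single_add_single_self, add_zero] at h2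

/-- Linearly independent edges form a forest. -/
theorem isAcyclic_of_card_le_edgeRank [Finite V] {A : Finset (Sym2 V)}
    (h : A.card ≤ edgeRank A) : (fromEdgeSet (A : Set (Sym2 V))).IsAcyclic := by
  have hli : LinearIndependent (ZMod 2) fun e : A => incVec (e : Sym2 V) := by
    rw [linearIndependent_iff_card_le_finrank_span, Fintype.card_coe]
    rw [show Set.range (fun e : A => incVec (e : Sym2 V)) = incVec '' (A : Set (Sym2 V)) by
      ext x; simp]
    exact h
  rw [isAcyclic_iff_forall_isBridge]
  intro e he
  induction e with
  | h u v =>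
  rw [isBridge_iff, deleteEdges_fromEdgeSet]
  intro hr
  have hmem := single_add_single_mem_span_of_reachable hr
  have heA : s(u, v) ∈ A := ((fromEdgeSet_adj _).1 he).1
  refine hli.notMem_span_image (s := {e | e ≠ ⟨s(u, v), heA⟩}) (x := ⟨s(u, v), heA⟩)
    (by simp) ?_
  refine Submodule.span_mono ?_ hmem
  rintro _ ⟨f, ⟨hf, hf'⟩, rfl⟩
  exact ⟨⟨f, hf⟩, fun h => hf' (congrArg Subtype.val h), rfl⟩

theorem edgeRank_mono [Finite V] {A B : Finset (Sym2 V)} (h : A ⊆ B) : edgeRank A ≤ edgeRank B :=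
  Submodule.finrank_mono (Submodule.span_mono (Set.image_mono (Finset.coe_subset.2 h)))

theorem edgeRank_submodular [Finite V] [DecidableEq (Sym2 V)] (A B : Finset (Sym2 V)) :
    edgeRank (A ∪ B) + edgeRank (A ∩ B) ≤ edgeRank A + edgeRank B := by
  unfold edgeRank
  rw [← Submodule.finrank_sup_add_finrank_inf_eq (Submodule.span (ZMod 2)
    (incVec '' (A : Set (Sym2 V)))) (Submodule.span (ZMod 2) (incVec '' (B : Set (Sym2 V)))),
    Finset.coe_union, Set.image_union, Submodule.span_union]
  refine Nat.add_le_add_left ?_ _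
  refine Submodule.finrank_mono (R := ZMod 2) (M := V → ZMod 2) (le_inf ?_ ?_) <;>
  · refine Submodule.span_mono (Set.image_mono (Finset.coe_subset.2 ?_))
    simp

theorem edgeRank_empty : edgeRank (∅ : Finset (Sym2 V)) = 0 := by
  rw [edgeRank, Finset.coe_empty, Set.image_empty, Submodule.span_empty, finrank_bot]

/-- The quotient by the span of the edges is generated by one vertex from each component. -/
theorem card_le_edgeRank_add_card_connectedComponent [Fintype V] (A : Finset (Sym2 V)) :
    Fintype.card V ≤ edgeRank A +
      Nat.card (fromEdgeSet (A : Set (Sym2 V))).ConnectedComponent := by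
  classical
  set H := fromEdgeSet (A : Set (Sym2 V))
  set W := Submodule.span (ZMod 2) (incVec '' (A : Set (Sym2 V)))
  have hquot := Submodule.finrank_quotient_add_finrank W
  rw [Module.finrank_fintype_fun_eq_card] at hquot
  have hspan : ⊤ ≤ Submodule.span (ZMod 2) (Set.range fun c : H.ConnectedComponent =>
      W.mkQ (Pi.single c.out 1)) := by
    rw [← W.range_mkQ, LinearMap.range_eq_map, ← (Pi.basisFun (ZMod 2) V).span_eq,
      Submodule.map_span_le]
    rintro _ ⟨v, rfl⟩
    have hr : H.Reachable v (H.connectedComponentMk v).out :=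
      ConnectedComponent.exact (Quot.out_eq (H.connectedComponentMk v)).symm
    have := (Submodule.Quotient.mk_eq_zero W).2 (single_add_single_mem_span_of_reachable hr)
    rw [Submodule.Quotient.mk_add] at this
    rw [Pi.basisFun_apply, Submodule.mkQ_apply, eq_neg_of_add_eq_zero_left this]
    exact Submodule.neg_mem _ (Submodule.subset_span ⟨_, rfl⟩)
  have hle := finrank_range_le_card (R := ZMod 2)
    (fun c : H.ConnectedComponent => W.mkQ (Pi.single c.out 1))
  rw [Set.finrank, top_le_iff.1 hspan, finrank_top, ← Nat.card_eq_fintype_card] at hle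
  have hW : edgeRank A = Module.finrank (ZMod 2) W := rfl
  omega

open Classical in
/-- The number of ordered pairs of adjacent vertices in `U`, that is, twice the number of edges of
`G` with both ends in `U`. -/
noncomputable def dartCount (G : SimpleGraph V) (U : Finset V) : ℕ :=
  ∑ i ∈ U, ∑ j ∈ U, if G.Adj i j then 1 else 0

omit [DecidableEq V] in
open Classical in
theorem dartCount_eq_card (G : SimpleGraph V) (U : Finset V) :
    G.dartCount U = ((U ×ˢ U).filter fun x => G.Adj x.1 x.2).card := by
  rw [dartCount, Finset.card_filter, Finset.sum_product]

/-- A forest has fewer edges inside a nonempty set of vertices than the set has elements. -/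
theorem IsAcyclic.dartCount_add_two_le {F : SimpleGraph V} (hF : F.IsAcyclic) {U : Finset V}
    (hU : U.Nonempty) : F.dartCount U + 2 ≤ 2 * U.card := by
  classical
  have : Nonempty U := hU.to_subtype
  obtain ⟨T, hFT, -, hT⟩ := (connected_top (V := U)).exists_isTree_le_of_le_of_isAcyclic le_top
    (hF.induce (U : Set V))
  have hcard := hT.card_edgeFinset
  have hdarts : 2 * T.edgeFinset.card =
      (Finset.univ.filter fun x : U × U => T.Adj x.1 x.2).card := two_mul_card_edgeFinset T
  rw [Fintype.card_coe] at hcard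
  have hle : F.dartCount U ≤ (Finset.univ.filter fun x : U × U => T.Adj x.1 x.2).card := by
    rw [dartCount_eq_card]
    refine Finset.card_le_card_of_injOn
      (fun x => if h : x.1 ∈ U ∧ x.2 ∈ U then (⟨x.1, h.1⟩, ⟨x.2, h.2⟩) else
        Classical.arbitrary _) ?_ ?_
    · rintro ⟨u, v⟩ h
      simp only [Finset.coe_filter, Finset.mem_product, Set.mem_ofPred_eq] at h
      simp only [h.1, and_self, dite_true, Finset.coe_filter, Finset.mem_univ, true_and,
        Set.mem_ofPred_eq]
      exact hFT h.2
    · rintro ⟨u, v⟩ h ⟨u', v'⟩ h' heq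
      simp only [Finset.coe_filter, Finset.mem_product, Set.mem_ofPred_eq] at h h'
      simpa [h.1, h'.1] using heq
  omega

theorem dartCount_add_le_of_arboricity_le [Finite V] {G : SimpleGraph V} {m : ℕ}
    (h : G.arboricity ≤ m) {U : Finset V} (hU : U.Nonempty) :
    G.dartCount U + 2 * m ≤ 2 * m * U.card := by
  classical
  obtain ⟨c, hc, hc'⟩ := (arboricity_le_iff _ _).1 h
  have h1 : G.dartCount U ≤
      ∑ i ∈ Finset.range m, (fromEdgeSet {e | e ∈ G.edgeSet ∧ c e = i}).dartCount U := by
    unfold dartCount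
    rw [Finset.sum_comm (s := Finset.range m)]
    refine Finset.sum_le_sum fun u _ => ?_
    rw [Finset.sum_comm (s := Finset.range m)]
    refine Finset.sum_le_sum fun v _ => ?_
    split_ifs with huv
    · have hadj : (fromEdgeSet {e | e ∈ G.edgeSet ∧ c e = c s(u, v)}).Adj u v :=
        (fromEdgeSet_adj _).2 ⟨⟨huv, rfl⟩, huv.ne⟩
      have := Finset.single_le_sum (f := fun i =>
        if (fromEdgeSet {e | e ∈ G.edgeSet ∧ c e = i}).Adj u v then 1 else (0 : ℕ))
        (s := Finset.range m) (fun _ _ => Nat.zero_le _) (Finset.mem_range.2 (hc s(u, v) huv))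
      rw [if_pos hadj] at this
      convert this
    · exact Nat.zero_le _
  have h2 : ∑ i ∈ Finset.range m, ((fromEdgeSet {e | e ∈ G.edgeSet ∧ c e = i}).dartCount U + 2) ≤
      ∑ _i ∈ Finset.range m, 2 * U.card :=
    Finset.sum_le_sum fun i _ => (hc' i).dartCount_add_two_le hU
  rw [Finset.sum_add_distrib] at h2
  simp only [Finset.sum_const, Finset.card_range, smul_eq_mul] at h2
  nlinarith

/-- The counting condition bounds the size of an edge set by a multiple of its rank: apply the
condition to the components of the set. -/
theorem card_le_mul_edgeRank [Fintype V] {G : SimpleGraph V} {m : ℕ}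
    (h : ∀ U : Finset V, U.Nonempty → G.dartCount U + 2 * m ≤ 2 * m * U.card)
    {A : Finset (Sym2 V)} (hA : (A : Set (Sym2 V)) ⊆ G.edgeSet) : A.card ≤ m * edgeRank A := by
  classical
  set H := fromEdgeSet (A : Set (Sym2 V)) with hH
  let supp : H.ConnectedComponent → Finset V := fun c =>
    Finset.univ.filter fun v => H.connectedComponentMk v = c
  have hHG : H ≤ G := (fromEdgeSet_mono hA).trans (by simp)
  have hAE : H.edgeFinset = A := by
    ext e
    rw [mem_edgeFinset, edgeSet_fromEdgeSet_of_subset hA, Finset.mem_coe]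
  have h1 : 2 * A.card ≤ ∑ c, G.dartCount (supp c) := by
    have hA2 : 2 * A.card = (Finset.univ.filter fun x : V × V => H.Adj x.1 x.2).card := by
      conv_lhs => rw [← hAE]
      convert two_mul_card_edgeFinset H
    rw [hA2, Finset.card_eq_sum_card_fiberwise
      (f := fun x => H.connectedComponentMk x.1) (t := Finset.univ) (by simp)]
    refine Finset.sum_le_sum fun c _ => ?_
    rw [dartCount_eq_card]
    refine Finset.card_le_card ?_
    rintro ⟨u, v⟩ hx
    simp only [Finset.mem_filter, Finset.mem_univ, true_and] at hx
    simp only [Finset.mem_filter, Finset.mem_product, supp, Finset.mem_univ, true_and]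
    exact ⟨⟨hx.2, (ConnectedComponent.sound hx.1.reachable.symm).trans hx.2⟩, hHG hx.1⟩
  have h2 : ∑ c, (G.dartCount (supp c) + 2 * m) ≤ ∑ c, 2 * m * (supp c).card := by
    refine Finset.sum_le_sum fun c _ => h _ ?_
    induction c using ConnectedComponent.ind with
    | h v => exact ⟨v, by simp [supp]⟩
  have h3 : ∑ c, (supp c).card = Fintype.card V :=
    (Finset.card_eq_sum_card_fiberwise (by simp)).symm
  -- by `h1` and `h2`, `2 * |A| + 2 * m * c ≤ 2 * m * |V|` for the number `c` of components
  have h4 := card_le_edgeRank_add_card_connectedComponent A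
  rw [← hH, Nat.card_eq_fintype_card] at h4
  rw [Finset.sum_add_distrib, ← Finset.mul_sum Finset.univ (fun c => (supp c).card), h3,
    Finset.sum_const, Finset.card_univ, smul_eq_mul] at h2
  have h5 := Nat.mul_le_mul_left (2 * m) h4
  nlinarith

/-- The theorem of Nash-Williams: a finite graph decomposes into `m` forests if and only if every
nonempty set `U` of vertices spans at most `m * (|U| - 1)` edges. -/
theorem arboricity_le_iff_dartCount [Fintype V] (G : SimpleGraph V) (m : ℕ) :
    G.arboricity ≤ m ↔
      ∀ U : Finset V, U.Nonempty → G.dartCount U + 2 * m ≤ 2 * m * U.card := by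
  classical
  refine ⟨fun h U hU => dartCount_add_le_of_arboricity_le h hU, fun h => ?_⟩
  obtain ⟨C, hC1, hC⟩ := exists_coloring_of_card_le_mul (ι := Fin m) edgeRank
    (fun _ _ => edgeRank_mono) edgeRank_submodular G.edgeFinset
    (fun A hA => by
      simpa using card_le_mul_edgeRank h (fun e he => mem_edgeFinset.1 (hA he)))
  have hne : ∀ e ∈ G.edgeFinset, ∃ n, ∃ hn : n < m, C e = {⟨n, hn⟩} := by
    intro e he
    obtain ⟨i, hi⟩ := Finset.card_eq_one.1 (le_antisymm (hC1 e he) (Finset.card_pos.2 (by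
      by_contra hemp
      rw [Finset.not_nonempty_iff_eq_empty] at hemp
      have := hC {e} (Finset.singleton_subset_iff.2 he)
      simp [Finset.filter_singleton, hemp, edgeRank_empty] at this)))
    exact ⟨i, i.2, hi⟩
  choose! g hgm hg using hne
  rw [arboricity_le_iff]
  refine ⟨g, fun e he => hgm e (mem_edgeFinset.2 he), fun i => ?_⟩
  by_cases hi : i < m
  · set A := G.edgeFinset.filter fun e => g e = i with hA
    have hmem : ∀ e ∈ A, C e = {⟨i, hi⟩} := by
      intro e he
      obtain ⟨he, hgi⟩ := Finset.mem_filter.1 he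
      rw [hg e he]
      simp [hgi]
    have hAE := hC A (Finset.filter_subset _ _)
    rw [Finset.sum_eq_single ⟨i, hi⟩ ?_ (by simp), Finset.filter_true_of_mem
      (fun e he => by simp [hmem e he])] at hAE
    · have := isAcyclic_of_card_le_edgeRank hAE
      refine isAcyclic_of_subset ?_ this
      intro e he
      simpa [hA] using he
    · intro j _ hj
      rw [Finset.filter_false_of_mem (fun e he => by simpa [hmem e he] using hj), edgeRank_empty]
  · refine isAcyclic_of_subset (T := ∅) ?_ (by simp)
    rintro e ⟨he, hgi⟩
    exact absurd (hgi ▸ hgm e (mem_edgeFinset.2 he)) hi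

end SimpleGraph

/-! ### Balanced token distributions -/

namespace SimpleGraph

open Finset

variable {n : ℕ}

/-- Every edge of `G` carries `2 * N` tokens, which it divides between its two ends: `x i j` is the
number of tokens at `i` of the edge `ij`. The load `L i` of a vertex is the number of its tokens
plus a fixed offset `d i`. -/
structure IsTokenDistribution (G : SimpleGraph (Fin n)) (N : ℕ) (d : Fin n → ℕ)
    (x : Fin n → Fin n → ℕ) (L : Fin n → ℕ) : Prop where
  tokens : ∀ i j, G.Adj i j → x i j + x j i = 2 * N
  noTokens : ∀ i j, ¬ G.Adj i j → x i j = 0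
  load : ∀ i, L i = ∑ j, x i j + d i

/-- No token can be moved along its edge to an end whose load is smaller by at least two. -/
def IsLocallyBalanced (x : Fin n → Fin n → ℕ) (L : Fin n → ℕ) : Prop :=
  ∀ i j, 0 < x i j → L i ≤ L j + 1

/-- The tokens after one token of the edge `ij` has moved from `i` to `j`. -/
def moveToken (x : Fin n → Fin n → ℕ) (i j : Fin n) : Fin n → Fin n → ℕ := fun a b =>
  if a = i ∧ b = j then x i j - 1 else if a = j ∧ b = i then x j i + 1 else x a b

/-- The loads after one token has moved from `i` to `j`. -/
def moveLoad (L : Fin n → ℕ) (i j : Fin n) : Fin n → ℕ := fun a =>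
  if a = i then L i - 1 else if a = j then L j + 1 else L a

namespace IsTokenDistribution

variable {G : SimpleGraph (Fin n)} {N : ℕ} {d : Fin n → ℕ} {x : Fin n → Fin n → ℕ}
  {L : Fin n → ℕ}

theorem adj_of_pos (h : IsTokenDistribution G N d x L) {i j : Fin n} (hx : 0 < x i j) :
    G.Adj i j := by
  by_contra hij
  have := h.noTokens i j hij
  omega

theorem move (h : IsTokenDistribution G N d x L) {i j : Fin n} (hx : 0 < x i j) :
    IsTokenDistribution G N d (moveToken x i j) (moveLoad L i j) := by
  have hadj := h.adj_of_pos hx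
  have hij := hadj.ne
  refine ⟨fun a b hab => ?_, fun a b hab => ?_, fun a => ?_⟩
  · have h1 := h.tokens a b hab
    unfold moveToken
    by_cases h2 : a = i ∧ b = j
    · obtain ⟨rfl, rfl⟩ := h2
      simp only [and_self, if_true, hij, hij.symm, if_false]
      omega
    · by_cases h3 : a = j ∧ b = i
      · obtain ⟨rfl, rfl⟩ := h3
        simp only [and_self, if_true, hij, hij.symm, if_false]
        omega
      · rw [if_neg h2, if_neg h3, if_neg (fun h => h3 h.symm), if_neg (fun h => h2 h.symm), h1]
  · unfold moveToken
    rw [if_neg (by rintro ⟨rfl, rfl⟩; exact hab hadj),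
      if_neg (by rintro ⟨rfl, rfl⟩; exact hab hadj.symm), h.noTokens a b hab]
  · have h1 := h.load a
    unfold moveToken moveLoad
    by_cases h2 : a = i
    · subst h2
      have h3 : ∀ f : Fin n → ℕ, ∑ b, f b = f j + ∑ b ∈ univ.erase j, f b := fun f =>
        (Finset.add_sum_erase _ _ (mem_univ j)).symm
      rw [h3] at h1 ⊢
      simp only [true_and, hij, false_and, if_false, if_true]
      have h4 : ∑ b ∈ univ.erase j, (if b = j then x a j - 1 else x a b) =
          ∑ b ∈ univ.erase j, x a b :=
        Finset.sum_congr rfl fun b hb => if_neg (Finset.ne_of_mem_erase hb)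
      rw [h4]
      omega
    · by_cases h5 : a = j
      · subst h5
        have h3 : ∀ f : Fin n → ℕ, ∑ b, f b = f i + ∑ b ∈ univ.erase i, f b := fun f =>
          (Finset.add_sum_erase _ _ (mem_univ i)).symm
        rw [h3] at h1 ⊢
        simp only [true_and, h2, false_and, if_false, if_true]
        have h4 : ∑ b ∈ univ.erase i, (if b = i then x a i + 1 else x a b) =
            ∑ b ∈ univ.erase i, x a b :=
          Finset.sum_congr rfl fun b hb => if_neg (Finset.ne_of_mem_erase hb)
        rw [h4]
        omega
      · simpa [h2, h5] using h1

/-- The potential that bounds the number of moves. -/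
theorem sum_sq_moveLoad_lt {i j : Fin n} (hij : i ≠ j) (hL : L j + 2 ≤ L i) :
    ∑ a, moveLoad L i j a ^ 2 < ∑ a, L a ^ 2 := by
  have h3 : ∀ f : Fin n → ℕ, ∑ b, f b = f i + (f j + ∑ b ∈ (univ.erase i).erase j, f b) := by
    intro f
    rw [Finset.add_sum_erase _ _ (mem_erase.2 ⟨hij.symm, mem_univ j⟩),
      Finset.add_sum_erase _ _ (mem_univ i)]
  rw [h3, h3 fun a => L a ^ 2]
  have h4 : ∑ b ∈ (univ.erase i).erase j, moveLoad L i j b ^ 2 =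
      ∑ b ∈ (univ.erase i).erase j, L b ^ 2 := by
    refine Finset.sum_congr rfl fun b hb => ?_
    have hb1 := Finset.ne_of_mem_erase hb
    have hb2 := Finset.ne_of_mem_erase (Finset.mem_of_mem_erase hb)
    simp [moveLoad, hb1, hb2]
  rw [h4]
  simp only [moveLoad, if_true, hij.symm, if_false]
  obtain ⟨c, hc⟩ := Nat.exists_eq_add_of_le hL
  rw [hc, show L j + 2 + c - 1 = L j + 1 + c by omega]
  nlinarith

/-- The number of tokens of the edges within `U`. -/
theorem sum_sum_eq (h : IsTokenDistribution G N d x L) (U : Finset (Fin n)) :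
    ∑ i ∈ U, ∑ j ∈ U, x i j = N * G.dartCount U := by
  have h1 : ∑ i ∈ U, ∑ j ∈ U, x i j + ∑ i ∈ U, ∑ j ∈ U, x j i = 2 * N * G.dartCount U := by
    rw [dartCount, ← Finset.sum_add_distrib, Finset.mul_sum]
    refine Finset.sum_congr rfl fun i _ => ?_
    rw [← Finset.sum_add_distrib, Finset.mul_sum]
    refine Finset.sum_congr rfl fun j _ => ?_
    split_ifs with hij
    · rw [h.tokens i j hij, mul_one]
    · rw [h.noTokens i j hij, h.noTokens j i (fun h => hij h.symm), mul_zero,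
        add_zero]
  rw [Finset.sum_comm (f := fun i j => x j i)] at h1
  linarith

/-- In a locally balanced distribution the counting condition keeps all loads small. To see this
for a vertex `v`, consider the sets of the vertices with load at least `L v - t`: for some `t < n`
the next such set is the same, and then all tokens in it come from edges inside it. -/
theorem load_lt (h : IsTokenDistribution G N d x L) (hbal : IsLocallyBalanced x L) {m : ℕ}
    (hd : ∑ i, d i ≤ 2 * N * m)
    (hG : ∀ U : Finset (Fin n), U.Nonempty → G.dartCount U + 2 * m ≤ 2 * m * U.card)
    (v : Fin n) : L v < 2 * N * m + n := by
  let U : ℕ → Finset (Fin n) := fun t => univ.filter fun u => L v ≤ L u + t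
  have hU : ∀ t u, u ∈ U t ↔ L v ≤ L u + t := fun t u => by simp [U]
  obtain ⟨t, ht, hUt⟩ : ∃ t < n, U (t + 1) ⊆ U t := by
    by_contra! hno
    have hgrow : ∀ t ≤ n, t + 1 ≤ (U t).card := by
      intro t
      induction t with
      | zero => exact fun _ => Finset.card_pos.2 ⟨v, by simp [hU]⟩
      | succ t ih =>
        intro ht
        have h1 := ih (by omega)
        have h2 : (U t).card < (U (t + 1)).card := Finset.card_lt_card
          ⟨fun u hu => by rw [hU] at hu ⊢; omega, hno t (by omega)⟩
        omega
    have h1 := hgrow n le_rfl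
    have h2 := Finset.card_le_univ (U n)
    rw [Fintype.card_fin] at h2
    omega
  have hv : v ∈ U t := by simp [hU]
  have hload : ∑ i ∈ U t, L i ≤ N * G.dartCount (U t) + 2 * N * m := by
    rw [← h.sum_sum_eq]
    have h1 : ∑ i ∈ U t, L i = ∑ i ∈ U t, ∑ j ∈ U t, x i j + ∑ i ∈ U t, d i := by
      rw [← Finset.sum_add_distrib]
      refine Finset.sum_congr rfl fun i hi => ?_
      rw [h.load i]
      congr 1
      refine (Finset.sum_subset (Finset.subset_univ _) fun j _ hj => ?_).symm
      by_contra hx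
      have h2 := hbal i j (Nat.pos_of_ne_zero hx)
      have h3 : j ∉ U (t + 1) := fun h => hj (hUt h)
      rw [hU] at hi h3
      omega
    rw [h1]
    exact Nat.add_le_add_left ((Finset.sum_le_univ_sum_of_nonneg fun _ => Nat.zero_le _).trans hd) _
  have hlow : (U t).card * L v ≤ ∑ i ∈ U t, L i + (U t).card * t := by
    have : ∑ _i ∈ U t, L v ≤ ∑ i ∈ U t, (L i + t) :=
      Finset.sum_le_sum fun i hi => (hU t i).1 hi
    simpa [Finset.sum_add_distrib] using this
  have hcount := Nat.mul_le_mul_left N (hG (U t) ⟨v, hv⟩)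
  have hcard : 0 < (U t).card := Finset.card_pos.2 ⟨v, hv⟩
  have hmain : (U t).card * L v ≤ (U t).card * (2 * N * m + t) := by
    calc (U t).card * L v ≤ N * (G.dartCount (U t) + 2 * m) + (U t).card * t := by
          linarith
      _ ≤ _ := by linarith
  have := Nat.le_of_mul_le_mul_left hmain hcard
  omega

/-- Small loads in spite of a large offset at a vertex of `U` show that `U` spans few edges. -/
theorem dartCount_le (h : IsTokenDistribution G N d x L) {m : ℕ} (hN : n * n ≤ N)
    (hL : ∀ v, L v < 2 * N * m + n) {U : Finset (Fin n)} {r : Fin n} (hr : r ∈ U)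
    (hd : 2 * N * m ≤ d r) : G.dartCount U + 2 * m ≤ 2 * m * U.card := by
  have h1 : N * G.dartCount U + 2 * N * m ≤ ∑ i ∈ U, L i := by
    rw [← h.sum_sum_eq]
    simp only [h.load, Finset.sum_add_distrib]
    refine Nat.add_le_add (Finset.sum_le_sum fun i _ => ?_) (hd.trans ?_)
    · exact Finset.sum_le_univ_sum_of_nonneg fun _ => Nat.zero_le _
    · exact Finset.single_le_sum (fun _ _ => Nat.zero_le _) hr
  have h2 : ∑ i ∈ U, (L i + 1) ≤ ∑ _i ∈ U, (2 * N * m + n) :=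
    Finset.sum_le_sum fun i _ => hL i
  rw [Finset.sum_add_distrib] at h2
  simp only [Finset.sum_const, smul_eq_mul, mul_one] at h2
  have hU1 : 0 < U.card := Finset.card_pos.2 ⟨r, hr⟩
  have hUn : U.card ≤ n := by simpa using Finset.card_le_univ U
  by_contra! hlt
  have h3 := Nat.mul_le_mul_left N hlt
  have h4 := Nat.mul_le_mul_right n hUn
  -- the surplus `N` of `h3` exceeds the rounding error, which is at most `|U| * (n - 1)`
  have h5 : N * (G.dartCount U + 2 * m) + U.card ≤ U.card * (2 * N * m + n) := by linarith
  have h6 : N * (2 * m * U.card + 1) = U.card * (2 * N * m) + N := by ring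
  have h7 : U.card * (2 * N * m + n) = U.card * (2 * N * m) + U.card * n := by ring
  have h8 : (2 * m * U.card).succ = 2 * m * U.card + 1 := rfl
  rw [h8] at h3
  omega

theorem load_le (h : IsTokenDistribution G N d x L) (i : Fin n) : L i ≤ n * (2 * N) + d i := by
  rw [h.load]
  refine Nat.add_le_add_right ?_ _
  have : ∑ j, x i j ≤ ∑ _j : Fin n, 2 * N := by
    refine Finset.sum_le_sum fun j _ => ?_
    by_cases hij : G.Adj i j
    · have := h.tokens i j hij
      omega
    · rw [h.noTokens i j hij]
      exact Nat.zero_le _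
  simpa using this

end IsTokenDistribution

/-- A graph on `n` vertices decomposes into `m` forests if `m ≥ n`. -/
theorem dartCount_add_le_of_card_le (G : SimpleGraph (Fin n)) {m : ℕ} (hm : n ≤ m)
    {U : Finset (Fin n)} (hU : U.Nonempty) : G.dartCount U + 2 * m ≤ 2 * m * U.card := by
  classical
  have h1 : G.dartCount U ≤ U.card * (U.card - 1) := by
    rw [dartCount_eq_card, Nat.mul_sub_one, ← Finset.offDiag_card]
    refine Finset.card_le_card fun x hx => ?_
    rw [Finset.mem_filter, Finset.mem_product] at hx
    exact Finset.mem_offDiag.2 ⟨hx.1.1, hx.1.2, hx.2.ne⟩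
  have hUn : U.card ≤ n := by simpa using Finset.card_le_univ U
  obtain ⟨u, hu⟩ := Nat.exists_eq_succ_of_ne_zero (Finset.card_pos.2 hU).ne'
  rw [hu] at h1 hUn ⊢
  simp only [Nat.succ_eq_add_one, Nat.add_sub_cancel] at h1 hUn ⊢
  have h2 := Nat.mul_le_mul_right u (hUn.trans hm)
  nlinarith

end SimpleGraph

/-! ### Reasoning about random access machine programs -/

namespace RAM

/-- Started in `s`, the program `p` halts within `t` steps in a state that satisfies `Q`. -/
def RunsWithin (p : Program) (s : State) (t : ℕ) (Q : State → Prop) : Prop :=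
  ∃ t' s', Runs p s t' s' ∧ t' ≤ t ∧ Q s'

variable {p q : Program} {s : State} {t t₁ t₂ : ℕ} {Q R : State → Prop}

theorem RunsWithin.mono (h : RunsWithin p s t Q) (ht : t ≤ t₁) (hQ : ∀ s, Q s → R s) :
    RunsWithin p s t₁ R := by
  obtain ⟨t', s', h1, h2, h3⟩ := h
  exact ⟨t', s', h1, h2.trans ht, hQ _ h3⟩

theorem RunsWithin.seq (hp : RunsWithin p s t₁ R) (hq : ∀ s', R s' → RunsWithin q s' t₂ Q) :
    RunsWithin (.seq p q) s (t₁ + t₂) Q := by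
  obtain ⟨a, s₁, h1, h2, h3⟩ := hp
  obtain ⟨b, s₂, h4, h5, h6⟩ := hq s₁ h3
  exact ⟨a + b, s₂, .seq h1 h4, by omega, h6⟩

theorem RunsWithin.ite {r : ℕ} (hp : s.reg r ≠ 0 → RunsWithin p s t Q)
    (hq : s.reg r = 0 → RunsWithin q s t Q) : RunsWithin (.ite r p q) s (t + 1) Q := by
  by_cases hr : s.reg r = 0
  · obtain ⟨a, s', h1, h2, h3⟩ := hq hr
    exact ⟨a + 1, s', .ite_false hr h1, by omega, h3⟩
  · obtain ⟨a, s', h1, h2, h3⟩ := hp hr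
    exact ⟨a + 1, s', .ite_true hr h1, by omega, h3⟩

/-- A loop whose invariant `I m` carries a natural number `m` that every round decreases. -/
theorem RunsWithin.loop {r : ℕ} (I : ℕ → State → Prop) (m : ℕ) (hs : I m s)
    (hbody : ∀ m s, I m s → s.reg r ≠ 0 → RunsWithin p s t fun s' => ∃ m' < m, I m' s')
    (hend : ∀ m s, I m s → s.reg r = 0 → Q s) :
    RunsWithin (.loop r p) s ((m + 1) * (t + 1)) Q := by
  induction m using Nat.strong_induction_on generalizing s with
  | _ m ih =>
  by_cases hr : s.reg r = 0
  · exact ⟨1, s, Runs.loop_stop hr, by nlinarith, hend m s hs hr⟩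
  · obtain ⟨a, s₁, h1, h2, m', hm', h3⟩ := hbody m s hs hr
    obtain ⟨b, s₂, h4, h5, h6⟩ := ih m' hm' h3
    refine ⟨a + b + 1, s₂, .loop_step hr h1 h4, ?_, h6⟩
    have : (m' + 1) * (t + 1) ≤ m * (t + 1) := Nat.mul_le_mul_right _ hm'
    nlinarith

/-- A loop that counts register `r` down from `m` to `0`. -/
theorem RunsWithin.forLoop {r m : ℕ} (I : ℕ → State → Prop) (hr : s.reg r = m) (hs : I 0 s)
    (hbody : ∀ i < m, ∀ s, s.reg r = m - i → I i s →
      RunsWithin p s t fun s' => s'.reg r = m - (i + 1) ∧ I (i + 1) s') :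
    RunsWithin (.loop r p) s ((m + 1) * (t + 1)) (I m) := by
  refine RunsWithin.loop (fun k s => k ≤ m ∧ s.reg r = k ∧ I (m - k) s) m
    ⟨le_rfl, hr, by simpa using hs⟩ ?_ ?_
  · rintro k s ⟨hk, hrk, hI⟩ hne
    rw [hrk] at hne
    refine (hbody (m - k) (by omega) s (by omega) hI).mono le_rfl ?_
    rintro s' ⟨h1, h2⟩
    refine ⟨k - 1, by omega, by omega, by omega, ?_⟩
    rwa [show m - (k - 1) = m - k + 1 by omega]
  · rintro k s ⟨-, hrk, hI⟩ h0
    rw [hrk] at h0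
    subst h0
    simpa using hI

/-- The final state of a program without loops. -/
def Program.exec : Program → State → State
  | .const r c, s => s.setReg r c
  | .add r a b, s => s.setReg r (s.reg a + s.reg b)
  | .sub r a b, s => s.setReg r (s.reg a - s.reg b)
  | .load r a, s => s.setReg r (s.mem (s.reg a))
  | .store a r, s => s.setMem (s.reg a) (s.reg r)
  | .seq p q, s => q.exec (p.exec s)
  | .ite r p q, s => if s.reg r = 0 then q.exec s else p.exec s
  | .loop _ _, s => s

/-- The number of steps that a program without loops can take at most. -/
def Program.cost : Program → ℕ
  | .seq p q => p.cost + q.cost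
  | .ite _ p q => max p.cost q.cost + 1
  | _ => 1

def Program.IsLoopFree : Program → Prop
  | .seq p q => p.IsLoopFree ∧ q.IsLoopFree
  | .ite _ p q => p.IsLoopFree ∧ q.IsLoopFree
  | .loop _ _ => False
  | _ => True

theorem RunsWithin.of_exec (hp : p.IsLoopFree) (ht : p.cost ≤ t) (hQ : Q (p.exec s)) :
    RunsWithin p s t Q := by
  suffices H : ∃ t ≤ p.cost, Runs p s t (p.exec s) by
    obtain ⟨t', ht', h⟩ := H
    exact ⟨t', _, h, ht'.trans ht, hQ⟩
  clear hQ ht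
  induction p generalizing s with
  | const r c => exact ⟨1, le_rfl, .const r c s⟩
  | add r a b => exact ⟨1, le_rfl, .add r a b s⟩
  | sub r a b => exact ⟨1, le_rfl, .sub r a b s⟩
  | load r a => exact ⟨1, le_rfl, .load r a s⟩
  | store a r => exact ⟨1, le_rfl, .store a r s⟩
  | seq p q ihp ihq =>
    obtain ⟨a, ha, h1⟩ := ihp (s := s) hp.1
    obtain ⟨b, hb, h2⟩ := ihq (s := p.exec s) hp.2
    exact ⟨a + b, Nat.add_le_add ha hb, .seq h1 h2⟩
  | ite r p q ihp ihq =>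
    by_cases hr : s.reg r = 0
    · obtain ⟨b, hb, h2⟩ := ihq (s := s) hp.2
      refine ⟨b + 1, Nat.succ_le_succ (hb.trans (le_max_right _ _)), ?_⟩
      rw [Program.exec, if_pos hr]
      exact .ite_false hr h2
    · obtain ⟨a, ha, h1⟩ := ihp (s := s) hp.1
      refine ⟨a + 1, Nat.succ_le_succ (ha.trans (le_max_left _ _)), ?_⟩
      rw [Program.exec, if_neg hr]
      exact .ite_true hr h1
  | loop r p => exact hp.elim

/-- Execute the programs of a list one after the other. -/
def Program.block : List Program → Program
  | [] => .const 17 0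
  | [p] => p
  | p :: q :: l => .seq p (block (q :: l))

end RAM

/-! ### The program -/

namespace ArboricityGameInstance

open RAM Program

/-- Run `body` for all `i`, `j` below `n`, row by row, with the addresses `2 + i * n + j`,
`2 + j * n + i`, `b + i`, `b + j` in the registers 9 to 12, where `b` is the content of
register 13. The registers 1 and 3 must contain `n` and `1`, and register 22 must contain `0`. The
registers 7 and 8 count the remaining rows and columns, and register 19 contains `2 + i`. -/
def grid (body : Program) : Program :=
  .seq (block [.const 9 2, .const 19 2, .add 11 13 22, .add 7 1 22])
    (.loop 7 (.seq (block [.add 8 1 22, .add 10 19 22, .add 12 13 22])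
      (.seq (.loop 8 (.seq body
          (block [.add 9 9 3, .add 10 10 1, .add 12 12 3, .sub 8 8 3])))
        (block [.add 11 11 3, .add 19 19 3, .sub 7 7 3]))))

/-- A bound for the running time of `grid body` if `body` takes at most `t` steps. -/
def gridTime (n t : ℕ) : ℕ := 4 + (n + 1) * (3 + ((n + 1) * (t + 4 + 1) + 3) + 1)

theorem runsWithin_grid {body : Program} {n b t : ℕ} (A : ℕ → State → Prop)
    (hA : ∀ k s s', s'.mem = s.mem →
      (∀ r, r ∉ ({7, 8, 9, 10, 11, 12, 19} : Finset ℕ) → s'.reg r = s.reg r) → A k s → A k s')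
    (hbody : ∀ i < n, ∀ j < n, ∀ s, A (i * n + j) s → s.reg 1 = n → s.reg 3 = 1 →
      s.reg 9 = 2 + i * n + j → s.reg 10 = 2 + j * n + i → s.reg 11 = b + i → s.reg 12 = b + j →
      RunsWithin body s t fun s' => A (i * n + j + 1) s' ∧
        ∀ r ∈ ({1, 3, 7, 8, 9, 10, 11, 12, 13, 19, 22} : Finset ℕ), s'.reg r = s.reg r)
    {s : State} (h1 : s.reg 1 = n) (h3 : s.reg 3 = 1) (h13 : s.reg 13 = b) (h22 : s.reg 22 = 0)
    (h0 : A 0 s) :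
    RunsWithin (grid body) s (gridTime n t) fun s' =>
      A (n * n) s' ∧ s'.reg 1 = n ∧ s'.reg 3 = 1 ∧ s'.reg 13 = b ∧ s'.reg 22 = 0 := by
  unfold grid gridTime
  refine RunsWithin.seq (RunsWithin.of_exec (Q := fun s => s.reg 7 = n ∧ A 0 s ∧ s.reg 1 = n ∧
    s.reg 3 = 1 ∧ s.reg 13 = b ∧ s.reg 22 = 0 ∧ s.reg 9 = 2 ∧ s.reg 11 = b ∧ s.reg 19 = 2)
    (by simp [block, IsLoopFree]) (by simp [block, cost]) ?_) ?_
  · refine ⟨?_, hA 0 s _ ?_ ?_ h0, ?_⟩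
    · simp [block, exec, State.setReg, h1, h22]
    · simp [block, exec, State.setReg]
    · intro r hr
      simp only [Finset.mem_insert, Finset.mem_singleton, not_or] at hr
      simp [block, exec, State.setReg, hr]
    · simp [block, exec, State.setReg, h1, h3, h13, h22]
  · rintro s ⟨h7, h0, h1, h3, h13, h22, h9, h11, h19⟩
    refine (RunsWithin.forLoop (fun i s => A (i * n) s ∧ s.reg 1 = n ∧
      s.reg 3 = 1 ∧ s.reg 13 = b ∧ s.reg 22 = 0 ∧ s.reg 9 = 2 + i * n ∧ s.reg 11 = b + i ∧
      s.reg 19 = 2 + i) (t := 3 + ((n + 1) * (t + 4 + 1) + 3)) h7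
      ⟨by simpa using h0, h1, h3, h13, h22, by simpa using h9, h11, h19⟩ ?_).mono le_rfl ?_
    · clear h0 h1 h3 h13 h22 h9 h11 h19 h7 s
      rintro i hi s h7 ⟨h0, h1, h3, h13, h22, h9, h11, h19⟩
      refine RunsWithin.seq (RunsWithin.of_exec (Q := fun s => s.reg 7 = n - i ∧ s.reg 8 = n ∧
        A (i * n) s ∧ s.reg 1 = n ∧ s.reg 3 = 1 ∧ s.reg 13 = b ∧ s.reg 22 = 0 ∧
        s.reg 9 = 2 + i * n ∧ s.reg 11 = b + i ∧ s.reg 19 = 2 + i ∧ s.reg 10 = 2 + i ∧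
        s.reg 12 = b) (by simp [block, IsLoopFree]) (by simp [block, cost]) ?_) ?_
      · refine ⟨?_, ?_, hA _ s _ ?_ ?_ h0, ?_⟩
        · simp [block, exec, State.setReg, h7]
        · simp [block, exec, State.setReg, h1, h22]
        · simp [block, exec, State.setReg]
        · intro r hr
          simp only [Finset.mem_insert, Finset.mem_singleton, not_or] at hr
          simp [block, exec, State.setReg, hr]
        · simp [block, exec, State.setReg, h1, h3, h13, h22, h9, h11, h19]
      · clear h0 h1 h3 h13 h22 h9 h11 h19 h7 s
        rintro s ⟨h7, h8, h0, h1, h3, h13, h22, h9, h11, h19, h10, h12⟩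
        refine RunsWithin.seq (RunsWithin.forLoop (fun j s => s.reg 7 = n - i ∧
          A (i * n + j) s ∧ s.reg 1 = n ∧ s.reg 3 = 1 ∧ s.reg 13 = b ∧ s.reg 22 = 0 ∧
          s.reg 9 = 2 + i * n + j ∧ s.reg 11 = b + i ∧ s.reg 19 = 2 + i ∧
          s.reg 10 = 2 + j * n + i ∧ s.reg 12 = b + j) (t := t + 4) h8
          ⟨h7, h0, h1, h3, h13, h22, h9, h11, h19, by simpa using h10, h12⟩ ?_) ?_
        · clear h0 h1 h3 h13 h22 h9 h11 h19 h7 h8 h10 h12 s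
          rintro j hj s h8 ⟨h7, h0, h1, h3, h13, h22, h9, h11, h19, h10, h12⟩
          refine (hbody i hi j hj s h0 h1 h3 h9 h10 h11 h12).seq ?_
          rintro s' ⟨h0', hfr⟩
          have g := fun r hr => hfr r hr
          simp only [Finset.mem_insert, Finset.mem_singleton, forall_eq_or_imp, forall_eq, h1, h3,
            h7, h8, h9, h10, h11, h12, h13, h19, h22] at g
          obtain ⟨g1, g3, g7, g8, g9, g10, g11, g12, g13, g19, g22⟩ := g
          refine RunsWithin.of_exec (by simp [block, IsLoopFree]) (by simp [block, cost])
            ⟨?_, ?_, hA _ s' _ ?_ ?_ h0', ?_⟩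
          · simp [block, exec, State.setReg, g8, g3]
            omega
          · simp [block, exec, State.setReg, g7]
          · simp [block, exec, State.setReg]
          · intro r hr
            simp only [Finset.mem_insert, Finset.mem_singleton, not_or] at hr
            simp [block, exec, State.setReg, hr]
          · simp [block, exec, State.setReg, g1, g3, g13, g22, g9, g11,
              g19, g10, g12]
            refine ⟨?_, ?_, ?_⟩ <;> ring
        · clear h0 h1 h3 h13 h22 h9 h11 h19 h7 h8 h10 h12 s
          rintro s ⟨h7, h0, h1, h3, h13, h22, h9, h11, h19, h10, h12⟩
          refine RunsWithin.of_exec (by simp [block, IsLoopFree]) (by simp [block, cost])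
            ⟨?_, hA _ s _ ?_ ?_ ?_, ?_⟩
          · simp [block, exec, State.setReg, h7, h3]
            omega
          · simp [block, exec, State.setReg]
          · intro r hr
            simp only [Finset.mem_insert, Finset.mem_singleton, not_or] at hr
            simp [block, exec, State.setReg, hr]
          · rwa [Nat.succ_mul]
          · simp [block, exec, State.setReg, h1, h3, h13, h22, h9, h11,
              h19]
            refine ⟨?_, ?_, ?_⟩ <;> ring
    · rintro s ⟨h0, h1, h3, h13, h22, -⟩
      exact ⟨h0, h1, h3, h13, h22⟩

end ArboricityGameInstance

namespace ArboricityGameInstance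

open RAM Program SimpleGraph

variable {n : ℕ}

/-- The memory holds the matrix `x` of tokens, in the place of the adjacency matrix, followed by
the loads `L`. -/
def Represents (mem : ℕ → ℕ) (x : Fin n → Fin n → ℕ) (L : Fin n → ℕ) : Prop :=
  (∀ i j : Fin n, mem (2 + i * n + j) = x i j) ∧ ∀ i : Fin n, mem (2 + n * n + i) = L i

theorem mul_add_lt_mul_self (i j : Fin n) : (i : ℕ) * n + j < n * n := by
  have h := Nat.mul_le_mul_right n i.2
  rw [Nat.succ_eq_add_one, Nat.succ_mul] at h
  have := j.2
  omega

theorem mul_add_inj {i j i' j' : Fin n} :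
    (i : ℕ) * n + j = i' * n + j' ↔ i = i' ∧ j = j' := by
  refine ⟨fun h => ?_, fun ⟨h1, h2⟩ => by rw [h1, h2]⟩
  have h1 : (i : ℕ) = i' := by
    have h2 : ((i : ℕ) * n + j) / n = (i' * n + j') / n := by rw [h]
    have hn : 0 < n := i.pos
    rwa [Nat.mul_comm (i : ℕ), Nat.mul_comm (i' : ℕ), Nat.mul_add_div hn, Nat.mul_add_div hn,
      Nat.div_eq_of_lt j.2, Nat.div_eq_of_lt j'.2, Nat.add_zero, Nat.add_zero] at h2
  rw [h1] at h
  exact ⟨Fin.ext h1, Fin.ext (by omega)⟩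

theorem mul_add_lt_succ_iff {i j i' j' : Fin n} :
    (i' : ℕ) * n + j' < i * n + j + 1 ↔ (i' : ℕ) * n + j' < i * n + j ∨ (i' = i ∧ j' = j) := by
  rw [← mul_add_inj, Nat.lt_succ_iff_lt_or_eq]

/-- Store `N = n ^ 2` tokens in each nonzero entry of the matrix and add them to the loads. Along
the way `n ^ 2` summands from register 5 are added up in register 6. -/
def initBody : Program :=
  block [.add 6 6 5, .load 17 9,
    .ite 17 (block [.store 9 4, .load 18 11, .add 18 18 4, .store 11 18]) (.const 17 0)]

/-- Move a token from `i` to `j` if that makes the loads more equal, and raise the flag in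
register 14 in this case. -/
def balanceBody : Program :=
  block [.load 17 9, .load 18 11, .load 20 12, .load 23 10, .sub 21 18 20, .sub 21 21 3,
    .ite 17
      (.ite 21
        (block [.sub 17 17 3, .store 9 17, .add 23 23 3, .store 10 23, .sub 18 18 3, .store 11 18,
          .add 20 20 3, .store 12 20, .const 14 1])
        (.const 17 0))
      (.const 17 0)]

/-- Set register 0 to `1` if the load of `i` exceeds the content of register 24. -/
def checkBody : Program :=
  block [.load 17 11, .sub 17 17 24, .ite 17 (.const 0 1) (.const 17 0)]

/-- The work for one vertex, whose load has its address in register 16: while the load is raised by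
the content of register 6, balance the loads and compare them with the threshold. -/
def rootBody : Program :=
  .seq (block [.load 17 16, .add 17 17 6, .store 16 17, .const 14 1])
    (.seq (.loop 14 (.seq (.const 14 0) (grid balanceBody)))
      (.seq (grid checkBody)
        (block [.load 17 16, .sub 17 17 6, .store 16 17, .add 16 16 3, .sub 15 15 3])))

/-- The decision procedure. For `1 ≤ k ≤ n`, register 4 receives `N = n ^ 2`, register 5 the number
`4 * (k - 1)`, register 6 their product `D`, register 13 the address `2 + n ^ 2` of the first load,
and register 24 the threshold `D + n - 1`. -/
def program : Program :=
  .seq (block [.const 3 1, .load 1 22, .load 2 3, .sub 17 2 1])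
    (.ite 2
      (.ite 17 (.const 17 0)
        (.seq (block [.sub 5 2 3, .add 5 5 5, .add 5 5 5, .add 7 1 22])
          (.seq (.loop 7 (block [.add 4 4 1, .sub 7 7 3]))
            (.seq (block [.add 13 4 3, .add 13 13 3])
              (.seq (grid initBody)
                (.seq (block [.add 24 6 1, .sub 24 24 3, .add 15 1 22, .add 16 13 22])
                  (.loop 15 rootBody)))))))
      (.const 0 1))

/-- The effect of `initBody` at the entry `ij`, when the first `k` entries have been treated. -/
theorem init_step {G : SimpleGraph (Fin n)} [DecidableRel G.Adj] {N c k : ℕ}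
    {i j : Fin n} {s : State}
    (h9 : s.reg 9 = 2 + i * n + j) (h11 : s.reg 11 = 2 + n * n + i) (h4 : s.reg 4 = N)
    (h5 : s.reg 5 = c) (h6 : s.reg 6 = k * c)
    (hk : k = i * n + j)
    (hmem : Represents s.mem
      (fun i j => if G.Adj i j then if (i : ℕ) * n + j < k then N else 1 else 0)
      (fun i => ∑ j : Fin n, if G.Adj i j ∧ (i : ℕ) * n + j < k then N else 0)) :
    (initBody.exec s).reg 6 = (k + 1) * c ∧
    (∀ r ∈ ({0, 1, 3, 4, 5, 7, 8, 9, 10, 11, 12, 13, 19, 22} : Finset ℕ),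
      (initBody.exec s).reg r = s.reg r) ∧
    Represents (initBody.exec s).mem
      (fun i j => if G.Adj i j then if (i : ℕ) * n + j < k + 1 then N else 1 else 0)
      (fun i => ∑ j : Fin n, if G.Adj i j ∧ (i : ℕ) * n + j < k + 1 then N else 0) := by
  subst hk
  have hx := hmem.1 i j
  have hL := hmem.2 i
  have hlt := mul_add_lt_mul_self i j
  by_cases hij : G.Adj i j
  · simp only [hij, if_true, lt_irrefl, if_false] at hx
    have hne : (2 + n * n + (i : ℕ)) ≠ 2 + i * n + j := by omega
    have hexec : (initBody.exec s).mem = Function.update (Function.update s.mem (2 + i * n + j) N)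
        (2 + n * n + i) (s.mem (2 + n * n + i) + N) := by
      simp [initBody, block, exec, State.setReg, State.setMem, h9, h11, h4, hx, hne]
    refine ⟨?_, ?_, ?_⟩
    · simp [initBody, block, exec, State.setReg, State.setMem, h9, hx, h5, h6]
      ring
    · simp [initBody, block, exec, State.setReg, State.setMem, h9, hx]
    · rw [hexec]
      refine ⟨fun i' j' => ?_, fun i' => ?_⟩
      · have hlt' := mul_add_lt_mul_self i' j'
        rw [Function.update_of_ne (by omega)]
        by_cases heq : i' = i ∧ j' = j
        · obtain ⟨rfl, rfl⟩ := heq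
          simp [hij]
        · have hne' : 2 + (i' : ℕ) * n + j' ≠ 2 + i * n + j := fun h =>
            heq (mul_add_inj.1 (by omega))
          rw [Function.update_of_ne hne', hmem.1 i' j']
          simp only [mul_add_lt_succ_iff, heq, or_false]
      · by_cases heq : i' = i
        · subst heq
          rw [Function.update_self, hL]
          have hsplit : ∀ j' : Fin n,
              (if G.Adj i' j' ∧ (i' : ℕ) * n + j' < i' * n + j + 1 then N else 0) =
              (if G.Adj i' j' ∧ (i' : ℕ) * n + j' < i' * n + j then N else 0) +
                if j' = j then N else 0 := by
            intro j'
            simp only [mul_add_lt_succ_iff, true_and]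
            by_cases hj : j' = j
            · subst hj
              simp [hij]
            · simp [hj]
          simp only [hsplit, Finset.sum_add_distrib, Finset.sum_ite_eq', Finset.mem_univ, if_true]
        · have hne' : (i' : ℕ) ≠ i := fun h => heq (Fin.ext h)
          rw [Function.update_of_ne (by omega), Function.update_of_ne (by omega), hmem.2 i']
          simp only [mul_add_lt_succ_iff, heq, false_and, or_false]
  · simp only [hij, if_false] at hx
    have hexec : (initBody.exec s).mem = s.mem := by
      simp [initBody, block, exec, State.setReg, h9, hx]
    refine ⟨?_, ?_, ?_⟩
    · simp [initBody, block, exec, State.setReg, h9, hx, h5, h6]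
      ring
    · simp [initBody, block, exec, State.setReg, h9, hx]
    · rw [hexec]
      refine ⟨fun i' j' => ?_, fun i' => ?_⟩
      · rw [hmem.1 i' j']
        by_cases heq : i' = i ∧ j' = j
        · obtain ⟨rfl, rfl⟩ := heq
          simp [hij]
        · simp only [mul_add_lt_succ_iff, heq, or_false]
      · rw [hmem.2 i']
        refine Finset.sum_congr rfl fun j' _ => ?_
        by_cases heq : i' = i ∧ j' = j
        · obtain ⟨rfl, rfl⟩ := heq
          simp [hij]
        · simp only [mul_add_lt_succ_iff, heq, or_false]

theorem represents_move {mem : ℕ → ℕ} {x : Fin n → Fin n → ℕ} {L : Fin n → ℕ}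
    (h : Represents mem x L) {i j : Fin n} (hij : i ≠ j) :
    Represents (Function.update (Function.update (Function.update (Function.update mem
      (2 + i * n + j) (x i j - 1)) (2 + j * n + i) (x j i + 1)) (2 + n * n + i) (L i - 1))
      (2 + n * n + j) (L j + 1)) (moveToken x i j) (moveLoad L i j) := by
  have h1 := mul_add_lt_mul_self i j
  have h2 := mul_add_lt_mul_self j i
  have hv : (i : ℕ) ≠ j := fun h => hij (Fin.ext h)
  refine ⟨fun a b => ?_, fun a => ?_⟩
  · have h3 := mul_add_lt_mul_self a b
    rw [Function.update_of_ne (by omega), Function.update_of_ne (by omega)]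
    unfold moveToken
    by_cases h4 : a = i ∧ b = j
    · obtain ⟨rfl, rfl⟩ := h4
      have hne : 2 + (a : ℕ) * n + b ≠ 2 + b * n + a := fun h =>
        hij (mul_add_inj.1 (by omega : (a : ℕ) * n + b = b * n + a)).1
      rw [Function.update_of_ne hne, Function.update_self]
      simp
    · by_cases h5 : a = j ∧ b = i
      · obtain ⟨rfl, rfl⟩ := h5
        rw [Function.update_self]
        simp [hij.symm]
      · have hne : 2 + (a : ℕ) * n + b ≠ 2 + j * n + i := fun h =>
          h5 (mul_add_inj.1 (by omega))
        have hne' : 2 + (a : ℕ) * n + b ≠ 2 + i * n + j := fun h =>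
          h4 (mul_add_inj.1 (by omega))
        rw [Function.update_of_ne hne, Function.update_of_ne hne', h.1, if_neg h4, if_neg h5]
  · unfold moveLoad
    by_cases h4 : a = i
    · subst h4
      rw [Function.update_of_ne (by omega), Function.update_self]
      simp
    · by_cases h5 : a = j
      · subst h5
        rw [Function.update_self]
        simp [hij.symm]
      · have hi : (a : ℕ) ≠ i := fun h => h4 (Fin.ext h)
        have hj : (a : ℕ) ≠ j := fun h => h5 (Fin.ext h)
        rw [Function.update_of_ne (by omega), Function.update_of_ne (by omega),
          Function.update_of_ne (by omega), Function.update_of_ne (by omega), h.2, if_neg h4,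
          if_neg h5]

/-- The effect of `balanceBody` at the entry `ij`, when the first `k` entries have been treated. If
the flag is down then nothing has been moved, so that the entries seen before are still balanced. -/
theorem balance_step {G : SimpleGraph (Fin n)} {N k Φ : ℕ} {d : Fin n → ℕ} {i j : Fin n}
    {s : State} (hk : k = i * n + j) (h3 : s.reg 3 = 1)
    (h9 : s.reg 9 = 2 + i * n + j) (h10 : s.reg 10 = 2 + j * n + i)
    (h11 : s.reg 11 = 2 + n * n + i) (h12 : s.reg 12 = 2 + n * n + j)
    (h : ∃ x L, Represents s.mem x L ∧ IsTokenDistribution G N d x L ∧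
      ∑ a, L a ^ 2 + s.reg 14 ≤ Φ ∧ s.reg 14 ≤ 1 ∧
      (s.reg 14 = 0 → ∀ a b : Fin n, (a : ℕ) * n + b < k → 0 < x a b → L a ≤ L b + 1)) :
    (∀ r ∈ ({0, 1, 3, 6, 7, 8, 9, 10, 11, 12, 13, 15, 16, 19, 22, 24} : Finset ℕ),
      (balanceBody.exec s).reg r = s.reg r) ∧
    ∃ x L, Represents (balanceBody.exec s).mem x L ∧ IsTokenDistribution G N d x L ∧
      ∑ a, L a ^ 2 + (balanceBody.exec s).reg 14 ≤ Φ ∧ (balanceBody.exec s).reg 14 ≤ 1 ∧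
      ((balanceBody.exec s).reg 14 = 0 →
        ∀ a b : Fin n, (a : ℕ) * n + b < k + 1 → 0 < x a b → L a ≤ L b + 1) := by
  subst hk
  obtain ⟨x, L, hrep, hdist, hΦ, hflag, hopt⟩ := h
  have hxij := hrep.1 i j
  have hxji := hrep.1 j i
  have hLi := hrep.2 i
  have hLj := hrep.2 j
  by_cases hmove : 0 < x i j ∧ L j + 2 ≤ L i
  · obtain ⟨hx, hL⟩ := hmove
    have hij := (hdist.adj_of_pos hx).ne
    have hx0 : x i j ≠ 0 := hx.ne'
    have hL0 : L i - L j - 1 ≠ 0 := by omega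
    have hmem : (balanceBody.exec s).mem = Function.update (Function.update (Function.update
        (Function.update s.mem (2 + i * n + j) (x i j - 1)) (2 + j * n + i) (x j i + 1))
        (2 + n * n + i) (L i - 1)) (2 + n * n + j) (L j + 1) := by
      simp [balanceBody, block, exec, State.setReg, State.setMem, h3, h9, h10, h11, h12, hxij, hxji,
        hLi, hLj, hx0, hL0]
    have h14 : (balanceBody.exec s).reg 14 = 1 := by
      simp [balanceBody, block, exec, State.setReg, State.setMem, h3, h9, h10, h11, h12, hxij,
        hLi, hLj, hx0, hL0]
    refine ⟨?_, moveToken x i j, moveLoad L i j, ?_, hdist.move hx, ?_, h14.le, by simp [h14]⟩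
    · simp [balanceBody, block, exec, State.setReg, State.setMem, h3, h9, h10, h11, h12, hxij,
        hLi, hLj, hx0, hL0]
    · rw [hmem]
      exact represents_move hrep hij
    · have := IsTokenDistribution.sum_sq_moveLoad_lt hij hL
      rw [h14]
      omega
  · have hexec : (balanceBody.exec s).mem = s.mem ∧
        (balanceBody.exec s).reg 14 = s.reg 14 ∧
        (∀ r ∈ ({0, 1, 3, 6, 7, 8, 9, 10, 11, 12, 13, 15, 16, 19, 22, 24} : Finset ℕ),
          (balanceBody.exec s).reg r = s.reg r) := by
      by_cases hx : x i j = 0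
      · simp [balanceBody, block, exec, State.setReg, h3, h9, h10, h11, h12, hxij, hLi, hLj, hx]
      · have hL0 : L i - L j - 1 = 0 := by
          by_contra h
          exact hmove ⟨Nat.pos_of_ne_zero hx, by omega⟩
        simp [balanceBody, block, exec, State.setReg, h3, h9, h10, h11, h12, hxij, hLi, hLj, hx,
          hL0]
    obtain ⟨hmem, h14, hfr⟩ := hexec
    refine ⟨hfr, x, L, by rwa [hmem], hdist, by rwa [h14], by rwa [h14], fun h0 a b hab hx => ?_⟩
    rw [h14] at h0
    rcases mul_add_lt_succ_iff.1 hab with hlt | ⟨rfl, rfl⟩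
    · exact hopt h0 a b hlt hx
    · by_contra hL
      exact hmove ⟨hx, by omega⟩

end ArboricityGameInstance

namespace ArboricityGameInstance

open RAM Program SimpleGraph

/-! ### Correctness of the loops -/

variable {n : ℕ} {G : SimpleGraph (Fin n)}

/-- The registers that `grid` relies on. -/
def GridReady (n : ℕ) (s : State) : Prop :=
  s.reg 1 = n ∧ s.reg 3 = 1 ∧ s.reg 13 = 2 + n * n ∧ s.reg 22 = 0

theorem runsWithin_initGrid [DecidableRel G.Adj] {c : ℕ} {s : State} (hs : GridReady n s)
    (h0 : s.reg 0 = 0) (h4 : s.reg 4 = n * n) (h5 : s.reg 5 = c) (h6 : s.reg 6 = 0)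
    (hmem : Represents s.mem (fun i j => if G.Adj i j then 1 else 0) (fun _ : Fin n => 0)) :
    RunsWithin (grid initBody) s (gridTime n 20) fun s' => GridReady n s' ∧ s'.reg 0 = 0 ∧
      s'.reg 6 = n * n * c ∧
      ∃ x L, Represents s'.mem x L ∧ IsTokenDistribution G (n * n) 0 x L := by
  obtain ⟨h1, h3, h13, h22⟩ := hs
  refine (runsWithin_grid (fun k s => s.reg 0 = 0 ∧ s.reg 4 = n * n ∧ s.reg 5 = c ∧
    s.reg 6 = k * c ∧ Represents s.mem
      (fun i j => if G.Adj i j then if (i : ℕ) * n + j < k then n * n else 1 else 0)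
      (fun i => ∑ j : Fin n, if G.Adj i j ∧ (i : ℕ) * n + j < k then n * n else 0))
    ?_ ?_ h1 h3 h13 h22 ?_).mono le_rfl ?_
  · intro k s s' hm hr
    rw [hm, hr 0 (by decide), hr 4 (by decide), hr 5 (by decide), hr 6 (by decide)]
    exact id
  · rintro i hi j hj s ⟨h0, h4, h5, h6, hmem⟩ - - h9 - h11 -
    obtain ⟨g1, g2, g3⟩ := init_step (i := ⟨i, hi⟩) (j := ⟨j, hj⟩) h9 h11 h4 h5 h6 rfl hmem
    refine RunsWithin.of_exec (by simp [initBody, block, IsLoopFree]) (by decide)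
      ⟨⟨?_, ?_, ?_, g1, g3⟩, fun r hr => g2 r (Finset.mem_of_subset (by decide) hr)⟩
    · rw [g2 0 (by decide), h0]
    · rw [g2 4 (by decide), h4]
    · rw [g2 5 (by decide), h5]
  · refine ⟨h0, h4, h5, by simpa using h6, ?_⟩
    simpa using hmem
  · rintro s' ⟨⟨h0, -, -, h6, hrep⟩, hs'⟩
    refine ⟨hs', h0, h6, _, _, hrep, ?_⟩
    simp only [mul_add_lt_mul_self, if_true, and_true]
    refine ⟨fun i j hij => ?_, fun i j hij => if_neg hij, fun i => by simp⟩
    rw [if_pos hij, if_pos hij.symm]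
    ring

/-- The invariant of a pass of `balanceBody`: the sum of the squares of the loads together with the
flag is bounded, and if the flag is down then the entries seen so far are balanced. -/
def BalanceInvariant (G : SimpleGraph (Fin n)) (d : Fin n → ℕ) (Φ k : ℕ) (s : State) : Prop :=
  ∃ x L, Represents s.mem x L ∧ IsTokenDistribution G (n * n) d x L ∧
    ∑ a, L a ^ 2 + s.reg 14 ≤ Φ ∧ s.reg 14 ≤ 1 ∧
    (s.reg 14 = 0 → ∀ a b : Fin n, (a : ℕ) * n + b < k → 0 < x a b → L a ≤ L b + 1)

theorem runsWithin_balanceGrid {d : Fin n → ℕ} {Φ : ℕ} {ρ : ℕ → ℕ} {s : State}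
    (hs : GridReady n s) (hρ : ∀ r ∈ ({0, 6, 15, 16, 24} : Finset ℕ), s.reg r = ρ r)
    (hinv : BalanceInvariant G d Φ 0 s) :
    RunsWithin (grid balanceBody) s (gridTime n 20) fun s' => GridReady n s' ∧
      (∀ r ∈ ({0, 6, 15, 16, 24} : Finset ℕ), s'.reg r = ρ r) ∧
      BalanceInvariant G d Φ (n * n) s' := by
  obtain ⟨h1, h3, h13, h22⟩ := hs
  refine (runsWithin_grid (fun k s => (∀ r ∈ ({0, 6, 15, 16, 24} : Finset ℕ), s.reg r = ρ r) ∧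
    BalanceInvariant G d Φ k s) ?_ ?_ h1 h3 h13 h22 ⟨hρ, hinv⟩).mono le_rfl ?_
  · rintro k s s' hm hr ⟨hρ, hinv⟩
    refine ⟨fun r hr' => ?_, ?_⟩
    · rw [← hρ r hr', hr r (Finset.disjoint_left.1 (by decide) hr')]
    · unfold BalanceInvariant
      rwa [hm, hr 14 (by decide)]
  · rintro i hi j hj s ⟨hρ, hinv⟩ - h3 h9 h10 h11 h12
    obtain ⟨g1, g2⟩ := balance_step (i := ⟨i, hi⟩) (j := ⟨j, hj⟩) rfl h3 h9 h10 h11 h12 hinv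
    refine RunsWithin.of_exec (by simp [balanceBody, block, IsLoopFree]) (by decide)
      ⟨⟨fun r hr => ?_, g2⟩, fun r hr => g1 r (Finset.mem_of_subset (by decide) hr)⟩
    rw [← hρ r hr, g1 r (Finset.mem_of_subset (by decide) hr)]
  · rintro s' ⟨⟨hρ, hinv⟩, hs'⟩
    exact ⟨hs', hρ, hinv⟩

/-- The passes are repeated until the distribution is locally balanced. Every pass but the last
decreases the sum of the squares of the loads. -/
theorem runsWithin_balanceLoop {d : Fin n → ℕ} {Φ : ℕ} {ρ : ℕ → ℕ} {s : State}
    {x : Fin n → Fin n → ℕ} {L : Fin n → ℕ}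
    (hs : GridReady n s) (hρ : ∀ r ∈ ({0, 6, 15, 16, 24} : Finset ℕ), s.reg r = ρ r)
    (h14 : s.reg 14 = 1) (hrep : Represents s.mem x L)
    (hdist : IsTokenDistribution G (n * n) d x L) (hΦ : ∑ a, L a ^ 2 ≤ Φ) :
    RunsWithin (.loop 14 (.seq (.const 14 0) (grid balanceBody))) s
      ((Φ + 2) * (1 + gridTime n 20 + 1)) fun s' => GridReady n s' ∧
        (∀ r ∈ ({0, 6, 15, 16, 24} : Finset ℕ), s'.reg r = ρ r) ∧
        ∃ x L, Represents s'.mem x L ∧ IsTokenDistribution G (n * n) d x L ∧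
          IsLocallyBalanced x L := by
  refine RunsWithin.loop (fun m s => GridReady n s ∧
    (∀ r ∈ ({0, 6, 15, 16, 24} : Finset ℕ), s.reg r = ρ r) ∧
    BalanceInvariant G d m (n * n) s) (Φ + 1)
    ⟨hs, hρ, x, L, hrep, hdist, by omega, h14.le, by simp [h14]⟩ ?_ ?_
  · rintro m s ⟨hs, hρ, x, L, hrep, hdist, hm, h14, -⟩ hne
    obtain ⟨h1, h3, h13, h22⟩ := hs
    refine RunsWithin.seq (RunsWithin.of_exec (Q := fun s => GridReady n s ∧
      (∀ r ∈ ({0, 6, 15, 16, 24} : Finset ℕ), s.reg r = ρ r) ∧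
      BalanceInvariant G d (m - 1) 0 s) trivial le_rfl ?_) ?_
    · refine ⟨?_, fun r hr => ?_, x, L, ?_, hdist, ?_, ?_, ?_⟩
      · simp [GridReady, exec, State.setReg, h1, h3, h13, h22]
      · rw [← hρ r hr]
        refine Function.update_of_ne ?_ _ _
        rintro rfl
        exact absurd hr (by decide)
      · exact hrep
      · simp only [exec, State.setReg, Function.update_self]
        omega
      · simp [exec, State.setReg]
      · simp
    · rintro s' ⟨hs', hρ', hinv⟩
      refine (runsWithin_balanceGrid hs' hρ' hinv).mono le_rfl ?_
      rintro s'' ⟨g1, g2, g3⟩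
      exact ⟨m - 1, by omega, g1, g2, g3⟩
  · rintro m s ⟨hs, hρ, x, L, hrep, hdist, -, -, hopt⟩ h14
    exact ⟨hs, hρ, x, L, hrep, hdist, fun a b => hopt h14 a b (mul_add_lt_mul_self a b)⟩

/-- Here `ρ` stands for the registers before the check, so that `ρ 0` is the old answer and `ρ 24`
the threshold. -/
theorem runsWithin_checkGrid {ρ : ℕ → ℕ} {s : State} {x : Fin n → Fin n → ℕ} {L : Fin n → ℕ}
    (hs : GridReady n s) (hρ : ∀ r ∈ ({0, 6, 15, 16, 24} : Finset ℕ), s.reg r = ρ r)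
    (hρ0 : ρ 0 ≤ 1) (hrep : Represents s.mem x L) :
    RunsWithin (grid checkBody) s (gridTime n 20) fun s' => GridReady n s' ∧
      (∀ r ∈ ({6, 15, 16, 24} : Finset ℕ), s'.reg r = ρ r) ∧ Represents s'.mem x L ∧
      s'.reg 0 ≤ 1 ∧ (s'.reg 0 = 0 ↔ ρ 0 = 0 ∧ ∀ i, L i ≤ ρ 24) := by
  obtain ⟨h1, h3, h13, h22⟩ := hs
  refine (runsWithin_grid (fun k s => (∀ r ∈ ({6, 15, 16, 24} : Finset ℕ), s.reg r = ρ r) ∧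
    Represents s.mem x L ∧ s.reg 0 ≤ 1 ∧
    (s.reg 0 = 0 ↔ ρ 0 = 0 ∧ ∀ i j : Fin n, (i : ℕ) * n + j < k → L i ≤ ρ 24))
    ?_ ?_ h1 h3 h13 h22 ?_).mono le_rfl ?_
  · rintro k s s' hm hr ⟨hρ, hinv⟩
    refine ⟨fun r hr' => ?_, ?_⟩
    · rw [← hρ r hr', hr r (Finset.disjoint_left.1 (by decide) hr')]
    · rwa [hm, hr 0 (by decide)]
  · rintro i hi j hj s ⟨hρ, hrep, h01, h0⟩ - - - - h11 -
    have h24 := hρ 24 (by decide)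
    have hL := hrep.2 ⟨i, hi⟩
    simp only at hL
    have hiff : (ρ 0 = 0 ∧ ∀ i' j' : Fin n, (i' : ℕ) * n + j' < i * n + j + 1 → L i' ≤ ρ 24) ↔
        s.reg 0 = 0 ∧ L ⟨i, hi⟩ ≤ ρ 24 := by
      rw [h0, and_assoc]
      refine and_congr_right fun _ => ?_
      have hlt := fun i' j' => mul_add_lt_succ_iff (i := ⟨i, hi⟩) (j := ⟨j, hj⟩) (i' := i')
        (j' := j')
      simp only at hlt
      simp only [hlt]
      constructor
      · exact fun h => ⟨fun i' j' hij => h i' j' (Or.inl hij), h _ _ (Or.inr ⟨rfl, rfl⟩)⟩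
      · rintro ⟨h, h'⟩ i' j' (hij | ⟨rfl, rfl⟩)
        · exact h i' j' hij
        · exact h'
    refine RunsWithin.of_exec (by simp [checkBody, block, IsLoopFree]) (by decide) ?_
    rw [hiff]
    by_cases hle : L ⟨i, hi⟩ ≤ ρ 24
    · have hsub : L ⟨i, hi⟩ - ρ 24 = 0 := by omega
      refine ⟨⟨?_, ?_, ?_, ?_⟩, ?_⟩
      · simpa [checkBody, block, exec, State.setReg, h11, hL, h24, hsub] using hρ
      · simpa [checkBody, block, exec, State.setReg, h11, hL, h24, hsub] using hrep
      · simpa [checkBody, block, exec, State.setReg, h11, hL, h24, hsub] using h01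
      · simp [checkBody, block, exec, State.setReg, h11, hL, h24, hsub, hle]
      · simp [checkBody, block, exec, State.setReg, h11, hL, h24, hsub]
    · have hsub : L ⟨i, hi⟩ - ρ 24 ≠ 0 := by omega
      refine ⟨⟨?_, ?_, ?_, ?_⟩, ?_⟩
      · simpa [checkBody, block, exec, State.setReg, h11, hL, h24, hsub] using hρ
      · simpa [checkBody, block, exec, State.setReg, h11, hL, h24, hsub] using hrep
      · simp [checkBody, block, exec, State.setReg, h11, hL, h24, hsub]
      · simp [checkBody, block, exec, State.setReg, h11, hL, h24, hsub, hle]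
      · simp [checkBody, block, exec, State.setReg, h11, hL, h24, hsub]
  · refine ⟨fun r hr => hρ r (Finset.mem_of_subset (by decide) hr), hrep, ?_, ?_⟩
    · rwa [hρ 0 (by decide)]
    · simp [hρ 0 (by decide)]
  · rintro s' ⟨⟨hρ, hrep, h01, h0⟩, hs'⟩
    refine ⟨hs', hρ, hrep, h01, h0.trans (and_congr_right fun _ => ?_)⟩
    exact ⟨fun h i => h i i (mul_add_lt_mul_self i i), fun h i _ _ => h i⟩

theorem represents_update {mem : ℕ → ℕ} {x : Fin n → Fin n → ℕ} {L : Fin n → ℕ}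
    (h : Represents mem x L) (r : Fin n) (v : ℕ) :
    Represents (Function.update mem (2 + n * n + r) v) x (Function.update L r v) := by
  refine ⟨fun i j => ?_, fun i => ?_⟩
  · have := mul_add_lt_mul_self i j
    rw [Function.update_of_ne (by omega), h.1]
  · by_cases hi : i = r
    · subst hi
      simp
    · have : (i : ℕ) ≠ r := fun h => hi (Fin.ext h)
      rw [Function.update_of_ne (by omega), Function.update_of_ne hi, h.2]

/-- A bound for the sum of the squares of the loads. -/
def loadBound (n : ℕ) : ℕ := n * (n * (2 * (n * n)) + n * n * (4 * n)) ^ 2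

/-- A bound for the running time of `rootBody`. -/
def rootTime (n : ℕ) : ℕ :=
  4 + ((loadBound n + 2) * (1 + gridTime n 20 + 1) + (gridTime n 20 + 5))

/-- The work for the root `r` yields a locally balanced distribution with the offset `D` at `r`; the
matrix that remains in memory serves as the initial distribution for the next root. -/
theorem runsWithin_rootBody {D : ℕ} (hD : D ≤ n * n * (4 * n)) (r : Fin n) {s : State}
    (hs : GridReady n s) (h0 : s.reg 0 ≤ 1) (h6 : s.reg 6 = D) (h16 : s.reg 16 = 2 + n * n + r)
    (hmem : ∃ x L, Represents s.mem x L ∧ IsTokenDistribution G (n * n) 0 x L) :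
    RunsWithin rootBody s (rootTime n) fun s' => GridReady n s' ∧ s'.reg 0 ≤ 1 ∧ s'.reg 6 = D ∧
      s'.reg 15 = s.reg 15 - 1 ∧ s'.reg 16 = 2 + n * n + (r + 1) ∧ s'.reg 24 = s.reg 24 ∧
      (∃ x L, Represents s'.mem x L ∧ IsTokenDistribution G (n * n) 0 x L) ∧
      ∃ x L, IsTokenDistribution G (n * n) (Pi.single r D) x L ∧ IsLocallyBalanced x L ∧
        (s'.reg 0 = 0 ↔ s.reg 0 = 0 ∧ ∀ i, L i ≤ s.reg 24) := by
  obtain ⟨x, L, hrep, hdist⟩ := hmem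
  have hLr := hrep.2 r
  obtain ⟨h1, h3, h13, h22⟩ := hs
  refine RunsWithin.seq (RunsWithin.of_exec (Q := fun s' => GridReady n s' ∧
    (∀ r ∈ ({0, 6, 15, 16, 24} : Finset ℕ), s'.reg r = s.reg r) ∧ s'.reg 14 = 1 ∧
    Represents s'.mem x (Function.update L r (L r + D)))
    (by simp [block, IsLoopFree]) (by decide) ?_) ?_
  · refine ⟨?_, ?_, ?_, ?_⟩
    · simp [GridReady, block, exec, State.setReg, State.setMem, h1, h3, h13, h22]
    · simp [block, exec, State.setReg, State.setMem]
    · simp [block, exec, State.setReg, State.setMem]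
    · rw [show (exec (block [.load 17 16, .add 17 17 6, .store 16 17, .const 14 1]) s).mem =
        Function.update s.mem (2 + n * n + r) (L r + D) by
          simp [block, exec, State.setReg, State.setMem, h16, hLr, h6]]
      exact represents_update hrep r _
  rintro s₁ ⟨hs₁, hρ, h14, hrep₁⟩
  have hdist₁ : IsTokenDistribution G (n * n) (Pi.single r D) x
      (Function.update L r (L r + D)) := by
    refine ⟨hdist.tokens, hdist.noTokens, fun i => ?_⟩
    have := hdist.load i
    by_cases hi : i = r
    · subst hi
      simpa using this
    · simpa [hi] using this
  have hΦ : ∑ a, (Function.update L r (L r + D)) a ^ 2 ≤ loadBound n := by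
    have : ∑ a, (Function.update L r (L r + D)) a ^ 2 ≤
        ∑ _a : Fin n, (n * (2 * (n * n)) + n * n * (4 * n)) ^ 2 := by
      refine Finset.sum_le_sum fun a _ => Nat.pow_le_pow_left ((hdist₁.load_le a).trans
        (Nat.add_le_add_left (le_trans ?_ hD) _)) 2
      by_cases ha : a = r
      · subst ha
        simp
      · simp [ha]
    simpa [loadBound] using this
  refine RunsWithin.seq (runsWithin_balanceLoop hs₁ hρ h14 hrep₁ hdist₁ hΦ) ?_
  rintro s₂ ⟨hs₂, hρ₂, x₂, L₂, hrep₂, hdist₂, hbal₂⟩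
  refine RunsWithin.seq (runsWithin_checkGrid hs₂ hρ₂ h0 hrep₂) ?_
  rintro s₃ ⟨⟨h1, h3, h13, h22⟩, hρ₃, hrep₃, h01, hiff⟩
  have g6 := hρ₃ 6 (by decide)
  have g15 := hρ₃ 15 (by decide)
  have g16 := hρ₃ 16 (by decide)
  have g24 := hρ₃ 24 (by decide)
  have hLr₃ := hrep₃.2 r
  refine RunsWithin.of_exec (by simp [block, IsLoopFree]) (by decide)
    ⟨?_, ?_, ?_, ?_, ?_, ?_, ?_, x₂, L₂, hdist₂, hbal₂, ?_⟩
  · simp [GridReady, block, exec, State.setReg, State.setMem, h1, h3, h13, h22]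
  · simpa [block, exec, State.setReg, State.setMem] using h01
  · simp [block, exec, State.setReg, State.setMem, g6, h6]
  · simp [block, exec, State.setReg, State.setMem, g15, h3]
  · simp [block, exec, State.setReg, State.setMem, g16, h3, h16]
    ring
  · simp [block, exec, State.setReg, State.setMem, g24]
  · refine ⟨x₂, Function.update L₂ r (L₂ r - D), ?_, hdist₂.tokens, hdist₂.noTokens,
      fun i => ?_⟩
    · rw [show (exec (block [.load 17 16, .sub 17 17 6, .store 16 17, .add 16 16 3,
          .sub 15 15 3]) s₃).mem = Function.update s₃.mem (2 + n * n + r) (L₂ r - D) by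
          simp [block, exec, State.setReg, State.setMem, g16, h16, hLr₃, g6, h6]]
      exact represents_update hrep₃ r _
    · have := hdist₂.load i
      by_cases hi : i = r
      · subst hi
        simp [this]
      · simpa [hi] using this
  · simpa [block, exec, State.setReg, State.setMem] using hiff

end ArboricityGameInstance

namespace ArboricityGameInstance

open RAM Program SimpleGraph

/-! ### The encoding of an instance in the memory -/

/-- The entries of a concatenation of rows of length `n`. -/
theorem getD_flatMap {α : Type*} (f : α → List ℕ) {n : ℕ} (hf : ∀ a, (f a).length = n)
    (l : List α) (i j : ℕ) (hi : i < l.length) (hj : j < n) :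
    (l.flatMap f).getD (i * n + j) 0 = (f l[i]).getD j 0 := by
  induction l generalizing i with
  | nil => exact absurd hi (Nat.not_lt_zero i)
  | cons a l ih =>
    rw [List.flatMap_cons]
    rcases i with _ | i
    · rw [List.getD_append _ _ _ _ (by rw [hf]; omega)]
      simp
    · have hlen : (i + 1) * n + j = n + (i * n + j) := by ring
      rw [List.getD_append_right _ _ _ _ (by rw [hf]; omega), hf, hlen, Nat.add_sub_cancel_left,
        ih i (by simpa using hi)]
      simp

theorem length_encode (I : ArboricityGameInstance) : I.encode.length = 2 + I.n * I.n := by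
  simp [encode, List.length_flatMap]
  ring

open Classical in
theorem represents_encode (I : ArboricityGameInstance) :
    Represents (initState I.encode).mem (fun i j => if I.G.Adj i j then 1 else 0) fun _ => 0 := by
  refine ⟨fun i j => ?_, fun i => ?_⟩
  · have h1 := getD_flatMap (fun i => (List.finRange I.n).map fun j =>
      if I.G.Adj i j then 1 else 0) (n := I.n) (by simp) (List.finRange I.n) i j (by simp) j.2
    have h2 : 2 + (i : ℕ) * I.n + j = (i * I.n + j) + 1 + 1 := by ring
    simp only [initState, encode, h2, List.getD_cons_succ, h1]
    simp [List.getD_eq_getElem?_getD]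
  · refine List.getD_eq_default _ _ ?_
    rw [length_encode]
    omega

theorem le_inputSize_encode (I : ArboricityGameInstance) : I.n ≤ inputSize I.encode := by
  have h1 : I.encode.length ≤ inputSize I.encode := by
    rw [inputSize, ← List.length_map (f := fun a => Nat.size a + 1)]
    exact List.length_le_sum_of_one_le _ fun a ha => by
      obtain ⟨b, -, rfl⟩ := List.mem_map.1 ha
      omega
  rw [length_encode] at h1
  nlinarith

/-! ### Correctness and running time of the program -/

/-- A bound for the running time of `program`. -/
def totalTime (n : ℕ) : ℕ :=
  4 + (4 + ((n + 1) * (2 + 1) + (2 + (gridTime n 20 + (4 + (n + 1) * (rootTime n + 1))))) + 1 + 1)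

theorem exists_polynomial_totalTime :
    ∃ T : Polynomial ℕ, ∀ n, T.eval n = totalTime n := by
  obtain ⟨P, hP⟩ : ∃ P : Polynomial ℕ, ∀ n, P.eval n = gridTime n 20 :=
    ⟨4 + (.X + 1) * (3 + ((.X + 1) * (20 + 4 + 1) + 3) + 1), fun n => by simp [gridTime]⟩
  obtain ⟨B, hB⟩ : ∃ B : Polynomial ℕ, ∀ n, B.eval n = loadBound n :=
    ⟨.X * (.X * (2 * (.X * .X)) + .X * .X * (4 * .X)) ^ 2, fun n => by simp [loadBound]⟩
  obtain ⟨R, hR⟩ : ∃ R : Polynomial ℕ, ∀ n, R.eval n = rootTime n :=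
    ⟨4 + ((B + 2) * (1 + P + 1) + (P + 5)), fun n => by simp [rootTime, hP, hB]⟩
  exact ⟨4 + (4 + ((.X + 1) * (2 + 1) + (2 + (P + (4 + (.X + 1) * (R + 1))))) + 1 + 1),
    fun n => by simp [totalTime, hP, hR]⟩

theorem totalTime_mono {a b : ℕ} (h : a ≤ b) : totalTime a ≤ totalTime b := by
  unfold totalTime rootTime loadBound gridTime
  gcongr

/-- After the loop over all roots, register 0 tells whether the counting condition fails. -/
theorem runsWithin_rootLoop {n m : ℕ} {G : SimpleGraph (Fin n)} {D : ℕ} (hn : 1 ≤ n)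
    (hDm : D = 2 * (n * n) * m) (hD : D ≤ n * n * (4 * n)) {s : State} (hs : GridReady n s)
    (h0 : s.reg 0 = 0) (h6 : s.reg 6 = D) (h15 : s.reg 15 = n) (h16 : s.reg 16 = 2 + n * n)
    (h24 : s.reg 24 = D + n - 1)
    (hmem : ∃ x L, Represents s.mem x L ∧ IsTokenDistribution G (n * n) 0 x L) :
    RunsWithin (.loop 15 rootBody) s ((n + 1) * (rootTime n + 1)) fun s' =>
      s'.reg 0 ≤ 1 ∧ (s'.reg 0 = 0 ↔
        ∀ U : Finset (Fin n), U.Nonempty → G.dartCount U + 2 * m ≤ 2 * m * U.card) := by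
  refine (RunsWithin.forLoop (fun t s => GridReady n s ∧ s.reg 0 ≤ 1 ∧ s.reg 6 = D ∧
    s.reg 16 = 2 + n * n + t ∧ s.reg 24 = D + n - 1 ∧
    (∃ x L, Represents s.mem x L ∧ IsTokenDistribution G (n * n) 0 x L) ∧
    (s.reg 0 = 0 → ∀ r : Fin n, (r : ℕ) < t → ∃ x L,
      IsTokenDistribution G (n * n) (Pi.single r D) x L ∧ ∀ i, L i < D + n) ∧
    (s.reg 0 ≠ 0 →
      ¬ ∀ U : Finset (Fin n), U.Nonempty → G.dartCount U + 2 * m ≤ 2 * m * U.card)) h15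
    ⟨hs, by omega, h6, h16, h24, hmem, by simp, by simp [h0]⟩ ?_).mono le_rfl ?_
  · rintro t ht s h15 ⟨hs, h01, h6, h16, h24, hmem, hgood, hbad⟩
    refine (runsWithin_rootBody hD ⟨t, ht⟩ hs h01 h6 h16 hmem).mono le_rfl ?_
    rintro s' ⟨hs', h01', h6', h15', h16', h24', hmem', x, L, hdist, hbal, hiff⟩
    refine ⟨by omega, hs', h01', h6', h16', h24'.trans h24, hmem', fun h0' r hr => ?_,
      fun h0' hG => ?_⟩
    · obtain ⟨h0, hL⟩ := hiff.1 h0'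
      rcases Nat.lt_succ_iff_lt_or_eq.1 hr with hlt | heq
      · exact hgood h0 r hlt
      · obtain rfl : r = ⟨t, ht⟩ := Fin.ext heq
        refine ⟨x, L, hdist, fun i => ?_⟩
        have := hL i
        omega
    · refine h0' (hiff.2 ⟨by_contra fun h0 => hbad h0 hG, fun i => ?_⟩)
      have := hdist.load_lt hbal (by simp [hDm]) hG i
      omega
  · rintro s ⟨-, h01, -, -, -, -, hgood, hbad⟩
    refine ⟨h01, fun h0 U ⟨r, hr⟩ => ?_, fun hG => by_contra fun h0 => hbad h0 hG⟩
    obtain ⟨x, L, hdist, hL⟩ := hgood h0 r r.2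
    exact hdist.dartCount_le le_rfl (by simpa [hDm] using hL) hr (by simp [hDm])

/-- For `k = 0` the answer is yes, for `k > n` it is no; otherwise the counting condition is tested
for `m = 2 * (k - 1)`. -/
theorem runsWithin_program (I : ArboricityGameInstance) :
    RunsWithin program (initState I.encode) (totalTime I.n) fun s =>
      (I.G.MakerWinsArboricityGame I.k → s.reg 0 = 1) ∧
        (¬ I.G.MakerWinsArboricityGame I.k → s.reg 0 = 0) := by
  classical
  rw [makerWinsArboricityGame_iff_two_mul, arboricity_le_iff_dartCount]
  have hmem := represents_encode I
  have hm0 : (initState I.encode).mem 0 = I.n := rfl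
  have hm1 : (initState I.encode).mem 1 = I.k := rfl
  have hreg : ∀ r, (initState I.encode).reg r = 0 := fun _ => rfl
  generalize initState I.encode = s at *
  obtain ⟨n, G, k⟩ := I
  simp only at *
  unfold program totalTime
  refine RunsWithin.seq (RunsWithin.of_exec (Q := fun s' => s'.mem = s.mem ∧ s'.reg 1 = n ∧
    s'.reg 2 = k ∧ s'.reg 3 = 1 ∧ s'.reg 17 = k - n ∧ ∀ r, 17 < r ∨ r = 0 ∨ (4 ≤ r ∧ r ≤ 16) →
      s'.reg r = 0)
    (by simp [block, IsLoopFree]) (by decide) ?_) ?_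
  · refine ⟨?_, ?_, ?_, ?_, ?_, fun r hr => ?_⟩
    · simp [block, exec, State.setReg]
    · simp [block, exec, State.setReg, hreg, hm0]
    · simp [block, exec, State.setReg, hreg, hm1]
    · simp [block, exec, State.setReg]
    · simp [block, exec, State.setReg, hreg, hm0, hm1]
    · have h17 : r ≠ 17 := by omega
      have h1 : r ≠ 1 := by omega
      have h2 : r ≠ 2 := by omega
      have h3 : r ≠ 3 := by omega
      simp [block, exec, State.setReg, h17, h1, h2, h3, hreg]
  rintro s₁ ⟨hs₁, h1, h2, h3, h17, hr⟩
  rw [← hs₁] at hmem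
  clear hs₁ hm0 hm1 hreg s
  refine RunsWithin.ite (fun hk => ?_) (fun hk => ?_)
  swap
  · refine RunsWithin.of_exec trivial (by simp [cost]) ?_
    have hk0 : k = 0 := h2 ▸ hk
    simp [hk0, exec, State.setReg]
  rw [h2] at hk
  refine RunsWithin.ite (fun hkn => ?_) (fun hkn => ?_)
  · rw [h17] at hkn
    refine RunsWithin.of_exec trivial (by simp [cost]; omega) ?_
    have hG : ∀ U : Finset (Fin n), U.Nonempty →
        G.dartCount U + 2 * (2 * (k - 1)) ≤ 2 * (2 * (k - 1)) * U.card := fun U hU =>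
      dartCount_add_le_of_card_le G (by omega) hU
    simpa [exec, State.setReg, hk, hr 0 (by omega)] using hG
  rw [h17] at hkn
  refine RunsWithin.seq (RunsWithin.of_exec (Q := fun s => s.mem = s₁.mem ∧ s.reg 1 = n ∧
    s.reg 3 = 1 ∧ s.reg 0 = 0 ∧ s.reg 4 = 0 ∧ s.reg 5 = 4 * (k - 1) ∧ s.reg 6 = 0 ∧ s.reg 7 = n ∧
    s.reg 22 = 0) (by simp [block, IsLoopFree]) (by decide) ?_) ?_
  · simp [block, exec, State.setReg, h1, h2, h3, hr]
    ring
  clear h1 h2 h3 h17 hr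
  rintro s₂ ⟨hs₂, h1, h3, h0, h4, h5, h6, h7, h22⟩
  refine RunsWithin.seq (RunsWithin.forLoop (t := 2) (fun i s => s.mem = s₁.mem ∧ s.reg 1 = n ∧
    s.reg 3 = 1 ∧ s.reg 0 = 0 ∧ s.reg 4 = i * n ∧ s.reg 5 = 4 * (k - 1) ∧ s.reg 6 = 0 ∧
    s.reg 22 = 0) h7 ⟨hs₂, h1, h3, h0, by simpa using h4, h5, h6, h22⟩ ?_) ?_
  · clear hs₂ h1 h3 h0 h4 h5 h6 h7 h22
    rintro i hi s h7 ⟨hs, h1, h3, h0, h4, h5, h6, h22⟩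
    refine RunsWithin.of_exec (by simp [block, IsLoopFree]) (by decide) ?_
    simp [block, exec, State.setReg, hs, h1, h3, h0, h4, h5, h6, h7, h22]
    refine ⟨by omega, by ring⟩
  clear hs₂ h1 h3 h0 h4 h5 h6 h7 h22 s₂
  rintro s₂ ⟨hs₂, h1, h3, h0, h4, h5, h6, h22⟩
  refine RunsWithin.seq (RunsWithin.of_exec (Q := fun s => s.mem = s₁.mem ∧ GridReady n s ∧
    s.reg 0 = 0 ∧ s.reg 4 = n * n ∧ s.reg 5 = 4 * (k - 1) ∧ s.reg 6 = 0)
    (by simp [block, IsLoopFree]) (by decide) ?_) ?_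
  · simp [GridReady, block, exec, State.setReg, hs₂, h1, h3, h0, h4, h5, h6, h22]
    ring
  clear hs₂ h1 h3 h0 h4 h5 h6 h22 s₂
  rintro s₂ ⟨hs₂, hready, h0, h4, h5, h6⟩
  refine RunsWithin.seq (runsWithin_initGrid hready h0 h4 h5 h6 (by rwa [hs₂])) ?_
  clear hs₂ hready h0 h4 h5 h6 s₂ hmem
  rintro s₂ ⟨⟨h1, h3, h13, h22⟩, h0, h6, hmem⟩
  refine RunsWithin.seq (RunsWithin.of_exec (Q := fun s => s.mem = s₂.mem ∧ GridReady n s ∧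
    s.reg 0 = 0 ∧ s.reg 6 = n * n * (4 * (k - 1)) ∧ s.reg 15 = n ∧ s.reg 16 = 2 + n * n ∧
    s.reg 24 = n * n * (4 * (k - 1)) + n - 1)
    (by simp [block, IsLoopFree]) (by decide) ?_) ?_
  · simp [GridReady, block, exec, State.setReg, h1, h3, h13, h22, h0, h6]
  rintro s₃ ⟨hs₃, hready, h0, h6, h15, h16, h24⟩
  rw [← hs₃] at hmem
  refine (runsWithin_rootLoop (m := 2 * (k - 1)) (by omega) (by ring)
    (Nat.mul_le_mul_left _ (by omega)) hready h0 h6 h15 h16 h24 hmem).mono le_rfl ?_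
  rintro s₄ ⟨h01, hiff⟩
  rw [← hiff]
  omega

theorem decidableInPolyTime :
    DecidableInPolyTime encode fun I => I.G.MakerWinsArboricityGame I.k := by
  obtain ⟨T, hT⟩ := exists_polynomial_totalTime
  refine ⟨program, T, fun I => ?_⟩
  obtain ⟨t, s, hrun, ht, hwin, hlose⟩ := runsWithin_program I
  refine ⟨t, s, hrun, ht.trans ?_, hwin, hlose⟩
  rw [hT]
  exact totalTime_mono (le_inputSize_encode I)

end ArboricityGameInstance

theorem theorem6p1 :
    -- the outcome of the arboricity-k game on a finite graph
    (∀ (V : Type*) [Finite V] (G : SimpleGraph V) (k : ℕ),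
      G.MakerWinsArboricityGame k ↔ k ≤ ⌈(G.arboricity : ℚ) / 2⌉₊) ∧
    -- for k = 2, the winning condition is that Maker claims a cycle, so it is the cycle game
    (∀ (V : Type*) [Finite V] (G : SimpleGraph V),
      (∀ M ⊆ G.edgeSet, 2 ≤ (SimpleGraph.fromEdgeSet M).arboricity ↔
        MakerBreaker.ClaimsSome G.cycleEdgeSets M) ∧
      (G.MakerWinsArboricityGame 2 ↔ G.MakerWinsCycleGame)) ∧
    -- deciding the winner on the input (G, k) in polynomial time
    RAM.DecidableInPolyTime ArboricityGameInstance.encode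
      (fun I => I.G.MakerWinsArboricityGame I.k) :=
  ⟨fun _ _ G k => G.makerWinsArboricityGame_iff k,
    fun _ _ G => ⟨fun _ hM => SimpleGraph.two_le_arboricity_iff hM,
      G.makerWinsArboricityGame_two_iff⟩,
    ArboricityGameInstance.decidableInPolyTime⟩
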